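/- For a sequence $\mathbf d=(d_1,\dots,d_n)$ of positive integers let $\Delta=\max_j d_j$, $n_i=|\{j: d_j=i\}|$ and $M_i=\sum_{j=1}^n (d_j)_i$, where $(x)_i=x(x-1)\cdots(x-i+1)$. If $\mathbf d$ is the degree sequence of some simple graph on the labelled vertex set $\{1,\dots,n\}$, let $\mathcal G(\mathbf d)$ be a uniformly random such graph (vertex $j$ having degree $d_j$). A graph is called symmetric if it has an automorphism other than the identity. Let $I$ be an infinite set of positive integers and, for each $n\in I$, let $\mathbf d=\mathbf d(n)$ be a sequence of $n$ positive integers that is the degree sequence of some simple graph. Asymptotics are for $n\to\infty$ within $I$, and $u=\omega(v)$ means $v=o(u)$. If $M_2=0$, the two quotients by $\sqrt{M_2}$ and $M_2$ below are read as $0$. Assume $\Delta^2=o(M_1)$. (a) If $n_1=\omega\big(M_1/\sqrt{M_2}\big)$ or $n_2=\omega\big(\sqrt{M_1^3/M_2}\big)$, then $\mathbb P(\mathcal G(\mathbf d)\text{ is symmetric})\to 1$. (b) For every $c>0$ there is $\delta=\delta(c)>0$, depending on $c$ only, such that for every such $I$ and every such family $(\mathbf d(n))_{n\in I}$ with $\Delta^2=o(M_1)$: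 if for all sufficiently large $n\in I$ $$n_1>c\,\frac{M_1}{\sqrt{M_2}}\quad\text{or}\quad n_2>c\sqrt{\frac{M_1^3}{M_2}},$$ then $\mathbb P(\mathcal G(\mathbf d)\text{ is symmetric})>\delta$ for all sufficiently large $n\in I$. -/

import Mathlib

open Filter Topology Asymptotics

namespace DegSeq

/-- A graph is symmetric if it has an automorphism different from the identity. -/
def IsSymmetric {V : Type*} (G : SimpleGraph V) : Prop :=
  ∃ φ : G ≃g G, φ ≠ SimpleGraph.Iso.refl

/-- The moment `M_i = ∑_j (d_j)_i` of a degree sequence, `(x)_i` being the falling factorial. -/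
def M {n : ℕ} (i : ℕ) (d : Fin n → ℕ) : ℕ := ∑ j, (d j).descFactorial i

/-- The number `n_j` of entries of a degree sequence that are equal to `j`. -/
def count {n : ℕ} (j : ℕ) (d : Fin n → ℕ) : ℕ := (Finset.univ.filter fun i => d i = j).card

/-- The largest entry `Δ` of a degree sequence. -/
def maxDeg {n : ℕ} (d : Fin n → ℕ) : ℕ := Finset.univ.sup d

open Classical in
/-- All simple graphs on the labelled vertex set `Fin n` in which every vertex `i` has
degree `d i`. -/
noncomputable def realizations {n : ℕ} (d : Fin n → ℕ) : Finset (SimpleGraph (Fin n)) :=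
  Finset.univ.filter fun G => ∀ i, G.degree i = d i

open Classical in
/-- The probability that the uniformly random graph with degree sequence `d` has property `Q`. -/
noncomputable def prob {n : ℕ} (d : Fin n → ℕ) (Q : SimpleGraph (Fin n) → Prop) : ℝ :=
  (((realizations d).filter Q).card : ℝ) / ((realizations d).card : ℝ)

/-- `n → ∞` within the set `I` of indices. -/
def along (I : Set ℕ) : Filter ℕ := atTop ⊓ 𝓟 I

/-- The setting of the theorem: `I` is an infinite set of positive integers and, for each `n ∈ I`,
`d n` is a degree sequence of length `n` with no zero entry that is realized by some simple
graph; moreover `Δ ^ 2 = o(M_1)` as `n → ∞` within `I`. -/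
structure Admissible (I : Set ℕ) (d : (n : ℕ) → Fin n → ℕ) : Prop where
  infinite : I.Infinite
  index_pos : ∀ n ∈ I, 1 ≤ n
  pos : ∀ n ∈ I, ∀ i, 1 ≤ d n i
  graphical : ∀ n ∈ I, (realizations (d n)).Nonempty
  maxDeg_sq : (fun n => ((maxDeg (d n) : ℝ)) ^ 2) =o[along I] (fun n => (M 1 (d n) : ℝ))

end DegSeq

open DegSeq

namespace DegSeq

/-! Symmetry is produced by twins: two vertices with the same neighbours elsewhere can be
interchanged. Two sources of twins suffice, namely two leaves with a common neighbour (a cherry),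
and two adjacent vertices of degree two with a common neighbour (a triangle).

When Δ² ≤ ε M_1 with ε small, switchings show that, given a bounded set S of edges, a further edge
uv has conditional probability (1 + O(ε)) d'_u d'_v / M_1, where d' is the degree left over by S.
The upper and lower bounds are `Sparse.card_containing_insert_le` and
`Sparse.le_card_containing_insert`. Adding edges one at a time gives about s² ordered cherries in
expectation, where s = n_1 √M_2 / M_1, and about 4l ordered triangles, where l = n_2² M_2 / M_1³.
The assumptions say exactly that s or l is bounded below, or tends to infinity.

By Cauchy–Schwarz, P(symmetric) ≥ (E X)² / E X² for either count X. Pairs of copies with disjoint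
twin sets contribute nearly (E X)², and overlapping pairs contribute lower order
(`Sparse.cherry_bound`, `Sparse.triangle_bound`). If s ≥ r or l ≥ r², both cases yield P ≥ (1 -
o(1)) / K(r) with K(r) = 1 + 4/r + 8/r². Taking r = c gives (b), and letting r grow gives (a). The
error depends on ε and r only, so δ depends on c only. If M_2 = 0, all degrees are one and every
realization is a perfect matching, which is symmetric. -/

open Classical in
lemma mem_realizations {n : ℕ} {d : Fin n → ℕ} {G : SimpleGraph (Fin n)} :
    G ∈ realizations d ↔ ∀ i, (Finset.univ.filter fun j => G.Adj i j).card = d i := by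
  simp only [realizations, Finset.mem_filter, Finset.mem_univ, true_and]
  refine forall_congr' fun i => ?_
  rw [← SimpleGraph.card_neighborFinset_eq_degree, SimpleGraph.neighborFinset_eq_filter]

/-- Two distinct vertices with the same neighbours elsewhere yield a non-trivial automorphism. -/
lemma isSymmetric_of_twins {V : Type*} {G : SimpleGraph V} {u v : V} (huv : u ≠ v)
    (h : ∀ w, w ≠ u → w ≠ v → (G.Adj u w ↔ G.Adj v w)) : IsSymmetric G := by
  classical
  refine ⟨⟨Equiv.swap u v, ?_⟩, ?_⟩
  · intro p q
    have := G.adj_comm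
    change G.Adj (Equiv.swap u v p) (Equiv.swap u v q) ↔ G.Adj p q
    simp only [Equiv.swap_apply_def]
    have hl := fun w => G.irrefl (v := w)
    split_ifs <;> grind
  · intro e
    have h1 := congrArg (fun f : G ≃g G => f u) e
    have h2 : Equiv.swap u v u = u := h1
    rw [Equiv.swap_apply_left] at h2
    exact huv h2.symm

/-! ### Switchings -/

/-- `uv` and `xy` are edges which can be switched to `ux` and `vy`. -/
structure Switchable {V : Type*} (G : SimpleGraph V) (u v x y : V) : Prop where
  adj₁ : G.Adj u v
  adj₂ : G.Adj x y
  not_adj₁ : ¬ G.Adj u x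
  not_adj₂ : ¬ G.Adj v y
  ne₁ : u ≠ x
  ne₂ : v ≠ y

/-- The graph obtained from `G` by toggling the edges of the closed walk `u v y x`. -/
def switch {V : Type*} (G : SimpleGraph V) (u v x y : V) : SimpleGraph V :=
  symmDiff G (SimpleGraph.fromEdgeSet {s(u, v), s(x, y), s(u, x), s(v, y)})

/-- Toggling a fixed edge set is an involution. Hence a graph can be recovered from its switched
version once the four vertices are recorded, which makes the counting maps below injective. -/
lemma switch_injective {V : Type*} (u v x y : V) :
    Function.Injective fun G : SimpleGraph V => switch G u v x y :=
  symmDiff_left_injective _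

lemma switch_adj {V : Type*} (G : SimpleGraph V) {u v x y p q : V} (hpq : p ≠ q) :
    (switch G u v x y).Adj p q ↔ Xor (G.Adj p q)
      (s(p, q) = s(u, v) ∨ s(p, q) = s(x, y) ∨ s(p, q) = s(u, x) ∨ s(p, q) = s(v, y)) := by
  simp only [switch, symmDiff_def, SimpleGraph.sup_adj, SimpleGraph.sdiff_adj,
    SimpleGraph.fromEdgeSet_adj, Set.mem_insert_iff, Set.mem_singleton_iff, Xor]
  tauto

namespace Switchable

variable {V : Type*} {G : SimpleGraph V} {u v x y : V}

lemma ne₃ (h : Switchable G u v x y) : u ≠ y := by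
  rintro rfl; exact h.not_adj₁ h.adj₂.symm

lemma ne₄ (h : Switchable G u v x y) : v ≠ x := by
  rintro rfl; exact h.not_adj₁ h.adj₁

/-- Switchings are reversible: exchanging the roles of `v` and `x` undoes one. -/
lemma switch (h : Switchable G u v x y) : Switchable (switch G u v x y) u x v y := by
  have h1 := h.adj₁
  have h2 := h.adj₂
  have h3 := h.not_adj₁
  have h4 := h.not_adj₂
  have n1 := h.ne₁
  have n2 := h.ne₂
  have n3 := h.ne₃
  have n4 := h.ne₄
  have n5 := h1.ne
  have n6 := h2.ne
  constructor
  · rw [switch_adj _ n1]; simp [Xor, h3]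
  · rw [switch_adj _ n2]; simp [Xor, h4]
  · rw [switch_adj _ n5]; simp [Xor, h1]
  · rw [switch_adj _ n6]; simp [Xor, h2]
  · exact n5
  · exact n6

lemma mem_edgeSet_switch (h : Switchable G u v x y) {e : Sym2 V} (he : e ∈ G.edgeSet)
    (h1 : e ≠ s(u, v)) (h2 : e ≠ s(x, y)) : e ∈ (DegSeq.switch G u v x y).edgeSet := by
  induction e with
  | _ p q =>
    have ha : G.Adj p q := he
    have h3 : s(p, q) ≠ s(u, x) := fun e => h.not_adj₁ (by
      rw [← SimpleGraph.mem_edgeSet, ← e]; exact he)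
    have h4 : s(p, q) ≠ s(v, y) := fun e => h.not_adj₂ (by
      rw [← SimpleGraph.mem_edgeSet, ← e]; exact he)
    rw [SimpleGraph.mem_edgeSet, switch_adj _ ha.ne]
    exact Or.inl ⟨ha, by simp only [h1, h2, h3, h4, or_self, not_false_eq_true]⟩

/-- The closed walk alternates between edges and non-edges, so each of its corners trades one
neighbour for another, and all other vertices keep their neighbourhoods. -/
lemma filter_adj_switch [Fintype V] (h : Switchable G u v x y) (w : V) :
    open Classical in
    (Finset.univ.filter fun j => (DegSeq.switch G u v x y).Adj w j).card =
      (Finset.univ.filter fun j => G.Adj w j).card := by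
  classical
  have key : ∀ w p q : V, G.Adj w p → ¬ G.Adj w q → w ≠ q →
      (∀ j, w ≠ j → ((s(w, j) = s(u, v) ∨ s(w, j) = s(x, y) ∨ s(w, j) = s(u, x) ∨
        s(w, j) = s(v, y)) ↔ j = p ∨ j = q)) →
      (Finset.univ.filter fun j => (DegSeq.switch G u v x y).Adj w j).card =
      (Finset.univ.filter fun j => G.Adj w j).card := by
    intro w p q hp hq hwq hj
    have : (Finset.univ.filter fun j => (DegSeq.switch G u v x y).Adj w j) =
        insert q ((Finset.univ.filter fun j => G.Adj w j).erase p) := by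
      ext j
      simp only [Finset.mem_filter, Finset.mem_univ, true_and, Finset.mem_insert,
        Finset.mem_erase]
      by_cases hwj : w = j
      · subst hwj; simp [hwq]
      · rw [switch_adj _ hwj, hj j hwj]
        have hpq : p ≠ q := by rintro rfl; exact hq hp
        unfold Xor
        constructor
        · rintro (⟨h1, h2⟩ | ⟨h1 | h1, h2⟩)
          · exact Or.inr ⟨fun e => h2 (Or.inl e), h1⟩
          · subst h1; exact absurd hp h2
          · exact Or.inl h1
        · rintro (rfl | ⟨h1, h2⟩)
          · exact Or.inr ⟨Or.inr rfl, hq⟩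
          · refine Or.inl ⟨h2, ?_⟩
            rintro (e | rfl)
            · exact h1 e
            · exact hq h2
    rw [this, Finset.card_insert_of_notMem, Finset.card_erase_add_one]
    · simpa using hp
    · simp [hq]
  have n1 := h.ne₁
  have n2 := h.ne₂
  have n3 := h.ne₃
  have n4 := h.ne₄
  have n5 := h.adj₁.ne
  have n6 := h.adj₂.ne
  by_cases hu : w = u
  · subst hu
    refine key w v x h.adj₁ h.not_adj₁ n1 fun j _ => ?_
    simp only [Sym2.eq_iff]; grind
  by_cases hv : w = v
  · subst hv
    refine key w u y h.adj₁.symm h.not_adj₂ n2 fun j _ => ?_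
    simp only [Sym2.eq_iff]; grind
  by_cases hx : w = x
  · subst hx
    refine key w y u h.adj₂ (fun e => h.not_adj₁ e.symm) n1.symm fun j _ => ?_
    simp only [Sym2.eq_iff]; grind
  by_cases hy : w = y
  · subst hy
    refine key w x v h.adj₂.symm (fun e => h.not_adj₂ e.symm) n2.symm fun j _ => ?_
    simp only [Sym2.eq_iff]; grind
  congr 1
  ext j
  simp only [Finset.mem_filter, Finset.mem_univ, true_and]
  by_cases hwj : w = j
  · subst hwj; simp
  · rw [switch_adj _ hwj]
    simp [hu, hv, hx, hy, Xor]

lemma switch_mem {n : ℕ} {d : Fin n → ℕ} {G : SimpleGraph (Fin n)} {u v x y : Fin n}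
    (h : Switchable G u v x y) (hG : G ∈ realizations d) :
    DegSeq.switch G u v x y ∈ realizations d := by
  rw [mem_realizations] at hG ⊢
  intro i
  rw [← hG i, h.filter_adj_switch]

end Switchable

/-! ### Counting realizations that contain prescribed edges -/

open Classical in
/-- The realizations of `d` that contain all the edges in `S`. -/
noncomputable def containing {n : ℕ} (d : Fin n → ℕ) (S : Finset (Sym2 (Fin n))) :
    Finset (SimpleGraph (Fin n)) :=
  (realizations d).filter fun G => ∀ e ∈ S, e ∈ G.edgeSet

/-- The number of edges in `S` at the vertex `u`. -/
def degIn {n : ℕ} (S : Finset (Sym2 (Fin n))) (u : Fin n) : ℕ :=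
  (Finset.univ.filter fun x => s(u, x) ∈ S).card

section

variable {n : ℕ} {d : Fin n → ℕ} {S : Finset (Sym2 (Fin n))} {G : SimpleGraph (Fin n)}

lemma mem_containing :
    G ∈ containing d S ↔ G ∈ realizations d ∧ ∀ e ∈ S, e ∈ G.edgeSet := by
  simp [containing]

lemma containing_subset : containing d S ⊆ realizations d := fun _ hG => (mem_containing.1 hG).1

lemma containing_empty : containing d (∅ : Finset (Sym2 (Fin n))) = realizations d := by
  ext; simp [mem_containing]

lemma mem_containing_insert {u v : Fin n} :
    G ∈ containing d (insert s(u, v) S) ↔ G ∈ containing d S ∧ G.Adj u v := by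
  simp only [mem_containing, Finset.forall_mem_insert, SimpleGraph.mem_edgeSet]
  tauto

lemma containing_insert_subset (e : Sym2 (Fin n)) :
    containing d (insert e S) ⊆ containing d S := by
  intro G
  simp only [mem_containing, Finset.forall_mem_insert]
  tauto

lemma M_one (d : Fin n → ℕ) : M 1 d = ∑ j, d j := by
  simp [M]

lemma le_maxDeg (d : Fin n → ℕ) (i : Fin n) : d i ≤ maxDeg d :=
  Finset.le_sup (f := d) (Finset.mem_univ i)

lemma card_filter_mem_sym2_le (S : Finset (Sym2 (Fin n))) :
    (Finset.univ.filter fun p : Fin n × Fin n => s(p.1, p.2) ∈ S).card ≤ 2 * S.card := by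
  refine Finset.card_le_mul_card_image_of_maps_to (f := fun p : Fin n × Fin n => s(p.1, p.2))
    (fun p hp => (Finset.mem_filter.1 hp).2) 2 fun e _ => ?_
  induction e with
  | _ a b =>
    refine (Finset.card_le_card (t := {(a, b), (b, a)}) fun p hp => ?_).trans Finset.card_le_two
    have h := (Finset.mem_filter.1 hp).2
    simp only [Sym2.eq_iff] at h
    simp only [Finset.mem_insert, Finset.mem_singleton, Prod.ext_iff]
    exact h

open Classical in
lemma card_darts (hG : G ∈ realizations d) :
    (Finset.univ.filter fun p : Fin n × Fin n => G.Adj p.1 p.2).card = M 1 d := by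
  rw [mem_realizations] at hG
  rw [M_one, Finset.card_filter, ← Finset.univ_product_univ, Finset.sum_product]
  refine Finset.sum_congr rfl fun i _ => ?_
  rw [← hG i, Finset.card_filter]

open Classical in
lemma card_darts_from_le (hG : G ∈ realizations d) (A : Finset (Fin n)) :
    (Finset.univ.filter fun p : Fin n × Fin n => G.Adj p.1 p.2 ∧ p.1 ∈ A).card
      ≤ A.card * maxDeg d := by
  rw [mem_realizations] at hG
  rw [Finset.card_filter, ← Finset.univ_product_univ, Finset.sum_product]
  calc _ ≤ ∑ i, if i ∈ A then maxDeg d else 0 := by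
        refine Finset.sum_le_sum fun i _ => ?_
        by_cases hi : i ∈ A
        · simp only [hi, and_true, if_true]
          rw [← Finset.card_filter, hG i]
          exact le_maxDeg d i
        · simp [hi]
    _ = _ := by simp

open Classical in
lemma card_darts_to_le (hG : G ∈ realizations d) (A : Finset (Fin n)) :
    (Finset.univ.filter fun p : Fin n × Fin n => G.Adj p.1 p.2 ∧ p.2 ∈ A).card
      ≤ A.card * maxDeg d := by
  refine le_trans (le_of_eq ?_) (card_darts_from_le hG A)
  refine Finset.card_bij (fun p _ => p.swap) ?_ ?_ ?_
  · intro p hp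
    simpa [G.adj_comm] using hp
  · intro p _ q _ h
    exact Prod.swap_injective h
  · intro p hp
    exact ⟨p.swap, by simpa [G.adj_comm] using hp, by simp⟩

open Classical in
lemma card_closed_nbhd_mul_le (hG : G ∈ realizations d) (u : Fin n) :
    (insert u (Finset.univ.filter fun x => G.Adj u x)).card * maxDeg d ≤ 2 * maxDeg d ^ 2 := by
  have h1 := Finset.card_insert_le u (Finset.univ.filter fun x => G.Adj u x)
  rw [mem_realizations.1 hG u] at h1
  have h2 := le_maxDeg d u
  rcases Nat.eq_zero_or_pos (maxDeg d) with h0 | h0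
  · simp [h0]
  · calc _ ≤ (2 * maxDeg d) * maxDeg d := Nat.mul_le_mul_right _ (by omega)
      _ = _ := by ring

open Classical in
/-- An edge of a realization can be switched with most of the other edges. -/
lemma card_switchable_ge (hG : G ∈ realizations d) {u v : Fin n} (huv : G.Adj u v) :
    M 1 d ≤ (Finset.univ.filter fun p : Fin n × Fin n =>
        Switchable G u v p.1 p.2 ∧ s(p.1, p.2) ∉ S).card + (4 * maxDeg d ^ 2 + 2 * S.card) := by
  rw [← card_darts hG]
  -- A dart (x, y) is unusable only if x is in the closed neighbourhood of u, y is in that of v, or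
  -- xy lies in `S`. The first two exclude at most 2Δ² darts each, the last at most 2|S|.
  set A := insert u (Finset.univ.filter fun x => G.Adj u x) with hA
  set B := insert v (Finset.univ.filter fun x => G.Adj v x) with hB
  have h1 := card_darts_from_le hG A
  have h2 := card_darts_to_le hG B
  have h3 := card_closed_nbhd_mul_le hG u
  have h4 := card_closed_nbhd_mul_le hG v
  rw [← hA] at h3
  rw [← hB] at h4
  have h5 := card_filter_mem_sym2_le S
  have h6 : (Finset.univ.filter fun p : Fin n × Fin n => G.Adj p.1 p.2) ⊆
      (Finset.univ.filter fun p : Fin n × Fin n =>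
        Switchable G u v p.1 p.2 ∧ s(p.1, p.2) ∉ S) ∪
      ((Finset.univ.filter fun p : Fin n × Fin n => G.Adj p.1 p.2 ∧ p.1 ∈ A) ∪
      ((Finset.univ.filter fun p : Fin n × Fin n => G.Adj p.1 p.2 ∧ p.2 ∈ B) ∪
      (Finset.univ.filter fun p : Fin n × Fin n => s(p.1, p.2) ∈ S))) := by
    rintro ⟨x, y⟩ hp
    simp only [Finset.mem_filter, Finset.mem_univ, true_and, Finset.mem_union, hA, hB,
      Finset.mem_insert] at hp ⊢
    by_cases c1 : x = u ∨ G.Adj u x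
    · exact Or.inr (Or.inl ⟨hp, c1⟩)
    by_cases c2 : y = v ∨ G.Adj v y
    · exact Or.inr (Or.inr (Or.inl ⟨hp, c2⟩))
    by_cases c3 : s(x, y) ∈ S
    · exact Or.inr (Or.inr (Or.inr c3))
    push Not at c1 c2
    exact Or.inl ⟨⟨huv, hp, c1.2, c2.2, c1.1.symm, c2.1.symm⟩, c3⟩
  have h7 := (Finset.card_le_card h6).trans ((Finset.card_union_le _ _).trans
    (Nat.add_le_add_left ((Finset.card_union_le _ _).trans
    (Nat.add_le_add_left (Finset.card_union_le _ _) _)) _))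
  omega

open Classical in
lemma card_new_nbrs (hG : G ∈ containing d S) (u : Fin n) :
    (Finset.univ.filter fun x => G.Adj u x ∧ s(u, x) ∉ S).card = d u - degIn S u := by
  obtain ⟨hR, hS⟩ := mem_containing.1 hG
  rw [← mem_realizations.1 hR u, degIn, ← Finset.card_sdiff_of_subset]
  · congr 1
    ext x
    simp
  · intro x hx
    simp only [Finset.mem_filter, Finset.mem_univ, true_and] at hx ⊢
    exact hS _ hx

open Classical in
lemma card_new_nbr_pairs (hG : G ∈ containing d S) (u v : Fin n) :
    (Finset.univ.filter fun p : Fin n × Fin n => (G.Adj u p.1 ∧ s(u, p.1) ∉ S) ∧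
      (G.Adj v p.2 ∧ s(v, p.2) ∉ S)).card = (d u - degIn S u) * (d v - degIn S v) := by
  rw [← card_new_nbrs hG u, ← card_new_nbrs hG v, ← Finset.card_product]
  congr 1
  ext p
  simp

/-- Upper bound for the number of realizations containing one more edge. -/
theorem card_containing_insert_mul_le {u v : Fin n} (hS : s(u, v) ∉ S) :
    (containing d (insert s(u, v) S)).card * (M 1 d - (4 * maxDeg d ^ 2 + 2 * S.card)) ≤
      (containing d S).card * ((d u - degIn S u) * (d v - degIn S v)) := by
  classical
  -- Double counting: a graph in `P` has the edge uv switched away using xy. The result has new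
  -- edges ux and vy outside `S`, so it is counted in `Q`, and the retained pair (x, y) makes the
  -- map injective.
  set P := (containing d (insert s(u, v) S)).sigma fun G => Finset.univ.filter
    fun p : Fin n × Fin n => Switchable G u v p.1 p.2 ∧ s(p.1, p.2) ∉ S with hP
  set Q := (containing d S).sigma fun G => Finset.univ.filter
    fun p : Fin n × Fin n => (G.Adj u p.1 ∧ s(u, p.1) ∉ S) ∧ (G.Adj v p.2 ∧ s(v, p.2) ∉ S) with hQ
  have h1 : (containing d (insert s(u, v) S)).card *
      (M 1 d - (4 * maxDeg d ^ 2 + 2 * S.card)) ≤ P.card := by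
    rw [hP, Finset.card_sigma, ← smul_eq_mul]
    refine Finset.card_nsmul_le_sum _ _ _ fun G hG => ?_
    obtain ⟨hG1, hG2⟩ := mem_containing_insert.1 hG
    have := card_switchable_ge (S := S) (containing_subset hG) hG2
    omega
  have h2 : Q.card = (containing d S).card * ((d u - degIn S u) * (d v - degIn S v)) := by
    rw [hQ, Finset.card_sigma, ← smul_eq_mul]
    exact Finset.sum_const_nat fun G hG => card_new_nbr_pairs hG u v
  rw [← h2]
  refine h1.trans (Finset.card_le_card_of_injOn
    (fun q => ⟨switch q.1 u v q.2.1 q.2.2, q.2⟩) ?_ ?_)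
  · rintro ⟨G, x, y⟩ h
    simp only [hP, Finset.coe_sigma, Set.mem_sigma_iff, Finset.mem_coe, Finset.mem_filter,
      Finset.mem_univ, true_and] at h
    obtain ⟨hG, hsw, hxy⟩ := h
    obtain ⟨hG1, hG2⟩ := mem_containing_insert.1 hG
    obtain ⟨hR, hGS⟩ := mem_containing.1 hG1
    have hs := hsw.switch
    simp only [hQ, Finset.coe_sigma, Set.mem_sigma_iff, Finset.mem_coe, Finset.mem_filter,
      Finset.mem_univ, true_and]
    refine ⟨mem_containing.2 ⟨hsw.switch_mem hR, fun e he => hsw.mem_edgeSet_switch (hGS e he)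
      (fun h => hS (h ▸ he)) (fun h => hxy (h ▸ he))⟩, ⟨hs.adj₁, fun h => ?_⟩,
      ⟨hs.adj₂, fun h => ?_⟩⟩
    · exact hsw.not_adj₁ (hGS _ h)
    · exact hsw.not_adj₂ (hGS _ h)
  · rintro ⟨G, p⟩ - ⟨G', p'⟩ - h
    simp only [Sigma.mk.injEq, heq_eq_eq] at h
    obtain ⟨h1, rfl⟩ := h
    have := switch_injective _ _ _ _ h1
    subst this
    rfl

open Classical in
/-- Lower bound for the number of realizations containing one more edge. -/
theorem card_containing_mul_le {u v : Fin n} (huv : u ≠ v) :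
    (containing d S).card * ((d u - degIn S u) * (d v - degIn S v)) ≤
      (containing d (insert s(u, v) S)).card * (M 1 d + maxDeg d ^ 2) +
      ∑ G ∈ containing d S, (Finset.univ.filter fun p : Fin n × Fin n =>
        (G.Adj u p.1 ∧ s(u, p.1) ∉ S) ∧ (G.Adj v p.2 ∧ s(v, p.2) ∉ S) ∧
        ¬ G.Adj u v ∧ (p.1 = p.2 ∨ G.Adj p.1 p.2)).card := by
  set Q := (containing d S).sigma fun G => Finset.univ.filter
    fun p : Fin n × Fin n => (G.Adj u p.1 ∧ s(u, p.1) ∉ S) ∧ (G.Adj v p.2 ∧ s(v, p.2) ∉ S) with hQ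
  have h2 : Q.card = (containing d S).card * ((d u - degIn S u) * (d v - degIn S v)) := by
    rw [hQ, Finset.card_sigma, ← smul_eq_mul]
    exact Finset.sum_const_nat fun G hG => card_new_nbr_pairs hG u v
  set Q₁ := (containing d (insert s(u, v) S)).sigma fun G => Finset.univ.filter
    fun p : Fin n × Fin n => (G.Adj u p.1 ∧ s(u, p.1) ∉ S) ∧ (G.Adj v p.2 ∧ s(v, p.2) ∉ S) with hQ₁
  set Q₂ := (containing d S).sigma fun G => Finset.univ.filter
    fun p : Fin n × Fin n => (G.Adj u p.1 ∧ s(u, p.1) ∉ S) ∧ (G.Adj v p.2 ∧ s(v, p.2) ∉ S) ∧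
        ¬ G.Adj u v ∧ (p.1 = p.2 ∨ G.Adj p.1 p.2) with hQ₂
  set Q₃ := (containing d S).sigma fun G => Finset.univ.filter
    fun p : Fin n × Fin n => Switchable G u p.1 v p.2 ∧ s(u, p.1) ∉ S ∧ s(v, p.2) ∉ S with hQ₃
  set P := (containing d (insert s(u, v) S)).sigma fun G => Finset.univ.filter
    fun p : Fin n × Fin n => G.Adj p.1 p.2 with hP
  -- Neighbours x of u and y of v allow a switching that creates uv (`Q₃`), unless uv is already an
  -- edge (`Q₁`) or x, y coincide or are adjacent (`Q₂`). Only `Q₂` needs a separate estimate.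
  have hsub : Q ⊆ (Q₃ ∪ Q₁) ∪ Q₂ := by
    rintro ⟨G, x, y⟩ h
    simp only [hQ, hQ₁, hQ₂, hQ₃, Finset.mem_sigma, Finset.mem_filter, Finset.mem_univ, true_and,
      Finset.mem_union] at h ⊢
    obtain ⟨hG, hx, hy⟩ := h
    by_cases c : G.Adj u v
    · exact Or.inl (Or.inr ⟨mem_containing_insert.2 ⟨hG, c⟩, hx, hy⟩)
    by_cases c' : x = y ∨ G.Adj x y
    · exact Or.inr ⟨hG, hx, hy, c, c'⟩
    push Not at c'
    exact Or.inl (Or.inl ⟨hG, ⟨hx.1, hy.1, c, c'.2, huv, c'.1⟩, hx.2, hy.2⟩)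
  have e1 : Q₁.card ≤ (containing d (insert s(u, v) S)).card * maxDeg d ^ 2 := by
    rw [hQ₁, Finset.card_sigma, ← smul_eq_mul]
    refine Finset.sum_le_card_nsmul _ _ _ fun G hG => ?_
    rw [card_new_nbr_pairs (containing_insert_subset _ hG), sq]
    exact Nat.mul_le_mul ((Nat.sub_le _ _).trans (le_maxDeg d u))
      ((Nat.sub_le _ _).trans (le_maxDeg d v))
  have e3 : P.card = (containing d (insert s(u, v) S)).card * M 1 d := by
    rw [hP, Finset.card_sigma, ← smul_eq_mul]
    exact Finset.sum_const_nat fun G hG => card_darts (containing_subset hG)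
  have e4 : Q₃.card ≤ P.card := by
    refine Finset.card_le_card_of_injOn (fun q => ⟨switch q.1 u q.2.1 v q.2.2, q.2⟩) ?_ ?_
    · rintro ⟨G, x, y⟩ h
      simp only [hQ₃, Finset.coe_sigma, Set.mem_sigma_iff, Finset.mem_coe, Finset.mem_filter,
        Finset.mem_univ, true_and] at h
      obtain ⟨hG, hsw, hx, hy⟩ := h
      obtain ⟨hR, hGS⟩ := mem_containing.1 hG
      have hs := hsw.switch
      simp only [hP, Finset.coe_sigma, Set.mem_sigma_iff, Finset.mem_coe, Finset.mem_filter,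
        Finset.mem_univ, true_and]
      exact ⟨mem_containing_insert.2 ⟨mem_containing.2 ⟨hsw.switch_mem hR, fun e he =>
        hsw.mem_edgeSet_switch (hGS e he) (fun h => hx (h ▸ he)) (fun h => hy (h ▸ he))⟩,
        hs.adj₁⟩, hs.adj₂⟩
    · rintro ⟨G, p⟩ - ⟨G', p'⟩ - h
      simp only [Sigma.mk.injEq, heq_eq_eq] at h
      obtain ⟨h1, rfl⟩ := h
      have := switch_injective _ _ _ _ h1
      subst this
      rfl
  have e5 := (Finset.card_le_card hsub).trans ((Finset.card_union_le _ _).trans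
    (Nat.add_le_add_right (Finset.card_union_le _ _) _))
  rw [← h2]
  have e2 : Q₂.card = _ := Finset.card_sigma _ _
  rw [← e2]
  rw [mul_add]
  omega

end

lemma degIn_mono {n : ℕ} {S T : Finset (Sym2 (Fin n))} (h : S ⊆ T) (u : Fin n) :
    degIn S u ≤ degIn T u :=
  Finset.card_le_card fun _ hx => by
    simp only [Finset.mem_filter, Finset.mem_univ, true_and] at hx ⊢
    exact h hx

lemma degIn_insert_pos {n : ℕ} {S : Finset (Sym2 (Fin n))} {u x : Fin n} (h : s(u, x) ∉ S) :
    degIn S u + 1 ≤ degIn (insert s(u, x) S) u := by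
  have : insert x (Finset.univ.filter fun y => s(u, y) ∈ S) ⊆
      Finset.univ.filter fun y => s(u, y) ∈ insert s(u, x) S := by
    intro y
    simp only [Finset.mem_insert, Finset.mem_filter, Finset.mem_univ, true_and]
    rintro (rfl | h)
    · exact Or.inl rfl
    · exact Or.inr h
  have h2 := Finset.card_le_card this
  rw [Finset.card_insert_of_notMem (by simpa using h)] at h2
  exact h2

lemma degIn_insert_le {n : ℕ} (S : Finset (Sym2 (Fin n))) (u x y : Fin n) :
    degIn (insert s(x, y) S) u ≤ degIn S u + 1 := by
  have : (Finset.univ.filter fun w => s(u, w) ∈ insert s(x, y) S) ⊆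
      insert (if u = x then y else x) (Finset.univ.filter fun w => s(u, w) ∈ S) := by
    intro w
    simp only [Finset.mem_insert, Finset.mem_filter, Finset.mem_univ, true_and, Sym2.eq_iff]
    rintro ((⟨rfl, rfl⟩ | ⟨rfl, rfl⟩) | h)
    · simp
    · left; split_ifs with h
      · exact h.symm ▸ rfl
      · rfl
    · exact Or.inr h
  exact (Finset.card_le_card this).trans (Finset.card_insert_le _ _)

lemma degIn_insert_of_ne {n : ℕ} (S : Finset (Sym2 (Fin n))) {u x y : Fin n} (hx : u ≠ x)
    (hy : u ≠ y) : degIn (insert s(x, y) S) u = degIn S u := by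
  unfold degIn
  congr 1
  ext w
  simp [hx, hy]

lemma degIn_empty {n : ℕ} (u : Fin n) : degIn (∅ : Finset (Sym2 (Fin n))) u = 0 := by
  simp [degIn]

/-! ### Edge probabilities for sparse degree sequences -/

/-- The degree sequence `d` is not constant zero and satisfies `Δ² ≤ ε M₁` with a small `ε`. -/
structure Sparse {n : ℕ} (d : Fin n → ℕ) (ε : ℝ) : Prop where
  pos : 0 < M 1 d
  -- This keeps 1 - 29ε nonnegative and 1 + 28ε at most 2.
  le : ε ≤ 1 / 29
  maxDeg_sq : (maxDeg d : ℝ) ^ 2 ≤ ε * M 1 d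

/-- Since Δ ≥ 1, also Δ ≤ Δ² ≤ εm. With κm ≤ 2, the three terms are at most 4ε, 16ε and 8ε times c,
which is where 28 comes from. They stand for x = y, for xy already in `S`, and for a new edge xy. -/
lemma bad_terms_le {κ Δ m ε c s₁ s₂ s₃ : ℝ} (hκ0 : 0 ≤ κ) (hκM : κ * m ≤ 2) (hΔ1 : 1 ≤ Δ)
    (hM1 : 1 ≤ m) (hε : 0 < ε) (hsq : Δ ^ 2 ≤ ε * m) (hc : 0 ≤ c) (h₁ : s₁ ≤ Δ * m)
    (h₂ : s₂ ≤ 4 * Δ ^ 2) (h₃ : s₃ ≤ (Δ * m) ^ 2) :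
    κ ^ 2 * c * s₁ + κ ^ 2 * c * s₂ + κ ^ 3 * c * s₃ ≤ 28 * ε * c := by
  have hκM0 : 0 ≤ κ * m := by positivity
  have hΔM : Δ ≤ ε * m := by nlinarith
  have hκ2 : (κ * m) ^ 2 ≤ 4 := by nlinarith
  have hκ3 : (κ * m) ^ 3 ≤ 8 := by
    calc (κ * m) ^ 3 ≤ 2 ^ 3 := by gcongr
      _ = 8 := by norm_num
  have hm0 : 0 ≤ m := by linarith
  have f1 : κ ^ 2 * (Δ * m) ≤ 4 * ε := by
    calc κ ^ 2 * (Δ * m) ≤ κ ^ 2 * ((ε * m) * m) := by gcongr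
      _ = (κ * m) ^ 2 * ε := by ring
      _ ≤ 4 * ε := by gcongr
  have f2 : κ ^ 2 * (4 * Δ ^ 2) ≤ 16 * ε := by
    have : Δ ^ 2 ≤ ε * m * m := hsq.trans (le_mul_of_one_le_right (by positivity) hM1)
    calc κ ^ 2 * (4 * Δ ^ 2) ≤ κ ^ 2 * (4 * (ε * m * m)) := by gcongr
      _ = (κ * m) ^ 2 * (4 * ε) := by ring
      _ ≤ 4 * (4 * ε) := by gcongr
      _ = _ := by ring
  have f3 : κ ^ 3 * (Δ * m) ^ 2 ≤ 8 * ε := by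
    calc κ ^ 3 * (Δ * m) ^ 2 = κ ^ 3 * (Δ ^ 2 * m ^ 2) := by ring
      _ ≤ κ ^ 3 * (ε * m * m ^ 2) := by gcongr
      _ = (κ * m) ^ 3 * ε := by ring
      _ ≤ 8 * ε := by gcongr
  calc _ ≤ κ ^ 2 * c * (Δ * m) + κ ^ 2 * c * (4 * Δ ^ 2) + κ ^ 3 * c * (Δ * m) ^ 2 := by gcongr
    _ = c * (κ ^ 2 * (Δ * m) + κ ^ 2 * (4 * Δ ^ 2) + κ ^ 3 * (Δ * m) ^ 2) := by ring
    _ ≤ c * (4 * ε + 16 * ε + 8 * ε) := by gcongr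
    _ = _ := by ring

namespace Sparse

variable {n : ℕ} {d : Fin n → ℕ} {ε : ℝ} {S : Finset (Sym2 (Fin n))}

lemma maxDeg_pos (h : Sparse d ε) : 1 ≤ maxDeg d := by
  by_contra hc
  have h0 : maxDeg d = 0 := by omega
  have := h.pos
  rw [M_one, Finset.sum_eq_zero fun i _ => ?_] at this
  · exact lt_irrefl _ this
  · have := le_maxDeg d i
    omega

lemma M_pos (h : Sparse d ε) : (0 : ℝ) < M 1 d := by exact_mod_cast h.pos

lemma eps_pos (h : Sparse d ε) : 0 < ε := by
  have h1 := h.maxDeg_sq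
  have h2 : (1 : ℝ) ≤ maxDeg d := by exact_mod_cast h.maxDeg_pos
  have h3 := h.M_pos
  by_contra hc
  push Not at hc
  nlinarith

/-- The loss in the switching count is 4Δ² + 2|S| ≤ 14Δ² ≤ 14εM_1, and (1 - 14ε)(1 + 28ε) ≥ 1 as ε ≤
1/28. Five prescribed edges are enough for building two triangles edge by edge. -/
lemma card_containing_insert_le' (h : Sparse d ε) (hS : S.card ≤ 5) {u v : Fin n}
    (huv : s(u, v) ∉ S) :
    ((containing d (insert s(u, v) S)).card : ℝ) ≤
      (1 + 28 * ε) / M 1 d * ((d u - degIn S u : ℕ) * (d v - degIn S v : ℕ)) *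
        (containing d S).card := by
  have h1 := card_containing_insert_mul_le (d := d) huv
  have hΔ : (1 : ℝ) ≤ maxDeg d := by exact_mod_cast h.maxDeg_pos
  have hε := h.eps_pos
  have hM := h.M_pos
  have hle := h.le
  have hsq := h.maxDeg_sq
  have hS' : (S.card : ℝ) ≤ 5 := by exact_mod_cast hS
  have h2 : (M 1 d : ℝ) * (1 - 14 * ε) ≤
      ((M 1 d - (4 * maxDeg d ^ 2 + 2 * S.card) : ℕ) : ℝ) := by
    have : ((M 1 d : ℕ) : ℝ) ≤ ((M 1 d - (4 * maxDeg d ^ 2 + 2 * S.card) : ℕ) : ℝ) +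
      (4 * maxDeg d ^ 2 + 2 * S.card) := by
      exact_mod_cast (by omega : M 1 d ≤ M 1 d - (4 * maxDeg d ^ 2 + 2 * S.card) +
        (4 * maxDeg d ^ 2 + 2 * S.card))
    nlinarith
  have h3 : ((containing d (insert s(u, v) S)).card : ℝ) * (M 1 d * (1 - 14 * ε)) ≤
      (containing d S).card * ((d u - degIn S u : ℕ) * (d v - degIn S v : ℕ)) :=
    (mul_le_mul_of_nonneg_left h2 (Nat.cast_nonneg _)).trans (by exact_mod_cast h1)
  have h4 : 1 ≤ (1 - 14 * ε) * (1 + 28 * ε) := by nlinarith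
  set X : ℝ := ((containing d (insert s(u, v) S)).card : ℝ)
  have hX : 0 ≤ X := Nat.cast_nonneg _
  have h5 : X * M 1 d ≤ X * M 1 d * ((1 - 14 * ε) * (1 + 28 * ε)) :=
    le_mul_of_one_le_right (by positivity) h4
  have h6 := mul_le_mul_of_nonneg_right h3 (by positivity : 0 ≤ 1 + 28 * ε)
  rw [div_mul_eq_mul_div, div_mul_eq_mul_div, le_div_iff₀ hM]
  linarith

/-- Upper bound for the number of realizations containing one more edge. -/
lemma card_containing_insert_le (h : Sparse d ε) (hS : S.card ≤ 5) {u v : Fin n}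
    (huv : s(u, v) ∉ S) {a b : ℕ} (ha : d u ≤ a + degIn S u) (hb : d v ≤ b + degIn S v) :
    ((containing d (insert s(u, v) S)).card : ℝ) ≤
      (1 + 28 * ε) / M 1 d * (a * b) * (containing d S).card := by
  refine (h.card_containing_insert_le' hS huv).trans ?_
  have hε := h.eps_pos
  have h1 : ((d u - degIn S u : ℕ) : ℝ) ≤ a := by exact_mod_cast (by omega)
  have h2 : ((d v - degIn S v : ℕ) : ℝ) ≤ b := by exact_mod_cast (by omega)
  gcongr

-- A bad pair (x, y) forces the edges ux and vy, and also the edge xy unless x = y or xy is in `S`.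
-- Each forced edge costs a factor κ times leftover degrees, by the upper bound applied two or three
-- times.
open Classical in
lemma card_bad_pair_le (h : Sparse d ε) (hS : S.card ≤ 2) {u v : Fin n} (huv : u ≠ v)
    (x y : Fin n) {a b : ℕ} (ha : a = d u - degIn S u) (hb : b = d v - degIn S v) {κ N : ℝ}
    (hκ : κ = (1 + 28 * ε) / M 1 d) (hN : N = (containing d S).card) :
    (((containing d S).filter fun G => (G.Adj u x ∧ s(u, x) ∉ S) ∧ (G.Adj v y ∧ s(v, y) ∉ S) ∧
        ¬ G.Adj u v ∧ (x = y ∨ G.Adj x y)).card : ℝ) ≤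
      κ ^ 2 * (a * b) * N * (if x = y then (d x : ℝ) ^ 2 else 0) +
      κ ^ 2 * (a * b) * N * (if s(x, y) ∈ S then (maxDeg d : ℝ) ^ 2 else 0) +
      κ ^ 3 * (a * b) * N * ((d x : ℝ) ^ 2 * (d y : ℝ) ^ 2) := by
  have hε := h.eps_pos
  have hM := h.M_pos
  have hκ0 : 0 ≤ κ := by rw [hκ]; positivity
  have hN0 : 0 ≤ N := by rw [hN]; positivity
  set F := (containing d S).filter fun G =>
      (G.Adj u x ∧ s(u, x) ∉ S) ∧ (G.Adj v y ∧ s(v, y) ∉ S) ∧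
      ¬ G.Adj u v ∧ (x = y ∨ G.Adj x y) with hF
  have t1 : 0 ≤ κ ^ 2 * (a * b) * N * (if x = y then (d x : ℝ) ^ 2 else 0) := by
    split_ifs <;> positivity
  have t2 : 0 ≤ κ ^ 2 * (a * b) * N * (if s(x, y) ∈ S then (maxDeg d : ℝ) ^ 2 else 0) := by
    split_ifs <;> positivity
  have t3 : 0 ≤ κ ^ 3 * (a * b) * N * ((d x : ℝ) ^ 2 * (d y : ℝ) ^ 2) := by positivity
  rcases F.eq_empty_or_nonempty with h0 | ⟨G, hG⟩
  · rw [h0]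
    simp only [Finset.card_empty, Nat.cast_zero]
    linarith
  simp only [hF, Finset.mem_filter] at hG
  obtain ⟨hG, ⟨hux, huxS⟩, ⟨hvy, hvyS⟩, hnuv, hxy⟩ := hG
  have hxv : x ≠ v := by rintro rfl; exact hnuv hux
  have hyu : y ≠ u := by rintro rfl; exact hnuv hvy.symm
  have hxu : x ≠ u := hux.ne'
  have hyv : y ≠ v := hvy.ne'
  have hne : s(v, y) ≠ s(u, x) := by
    simp only [ne_eq, Sym2.eq_iff]; grind
  have hS1 : s(v, y) ∉ insert s(u, x) S := by
    simp only [Finset.mem_insert, not_or]; exact ⟨hne, hvyS⟩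
  have c1 : (insert s(u, x) S).card ≤ 5 := (Finset.card_insert_le _ _).trans (by omega)
  have c2 : (insert s(v, y) (insert s(u, x) S)).card ≤ 5 :=
    (Finset.card_insert_le _ _).trans (by have := Finset.card_insert_le s(u, x) S; omega)
  have b1 := h.card_containing_insert_le (by omega) huxS (a := a) (b := d x)
    (by omega) (by omega)
  have b2 := h.card_containing_insert_le c1 hS1 (a := b) (b := d y)
    (by have := degIn_mono (Finset.subset_insert s(u, x) S) v; omega) (by omega)
  rw [← hκ] at b1 b2
  rw [← hN] at b1
  have b12 : ((containing d (insert s(v, y) (insert s(u, x) S))).card : ℝ) ≤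
      κ ^ 2 * (a * b) * N * (d x * d y) := by
    refine b2.trans ((mul_le_mul_of_nonneg_left b1 (by positivity)).trans (le_of_eq ?_))
    ring
  have hF1 : F ⊆ containing d (insert s(v, y) (insert s(u, x) S)) := by
    intro G' hG'
    simp only [hF, Finset.mem_filter] at hG'
    rw [mem_containing_insert, mem_containing_insert]
    tauto
  have hF1' : (F.card : ℝ) ≤ κ ^ 2 * (a * b) * N * (d x * d y) :=
    (Nat.cast_le.2 (Finset.card_le_card hF1)).trans b12
  have hdx : (d x : ℝ) ≤ maxDeg d := by exact_mod_cast le_maxDeg d x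
  have hdy : (d y : ℝ) ≤ maxDeg d := by exact_mod_cast le_maxDeg d y
  by_cases e1 : x = y
  · subst e1
    rw [if_pos rfl, sq (d x : ℝ)]
    linarith
  by_cases e2 : s(x, y) ∈ S
  · rw [if_pos e2] at t2 ⊢
    have : κ ^ 2 * (a * b) * N * (d x * d y) ≤ κ ^ 2 * (a * b) * N * (maxDeg d : ℝ) ^ 2 := by
      rw [sq (maxDeg d : ℝ)]; gcongr
    linarith
  have hS2 : s(x, y) ∉ insert s(v, y) (insert s(u, x) S) := by
    simp only [Finset.mem_insert, not_or, Sym2.eq_iff]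
    refine ⟨?_, ?_, e2⟩ <;> grind
  have b3 := h.card_containing_insert_le c2 hS2 (a := d x) (b := d y) (by omega) (by omega)
  have hF2 : F ⊆ containing d (insert s(x, y) (insert s(v, y) (insert s(u, x) S))) := by
    intro G' hG'
    have h1 := hF1 hG'
    simp only [hF, Finset.mem_filter] at hG'
    rw [mem_containing_insert]
    tauto
  have hF2' : (F.card : ℝ) ≤ κ ^ 3 * (a * b) * N * ((d x : ℝ) ^ 2 * (d y : ℝ) ^ 2) := by
    refine (Nat.cast_le.2 (Finset.card_le_card hF2)).trans (b3.trans
      ((mul_le_mul_of_nonneg_left b12 (by positivity)).trans (le_of_eq ?_)))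
    rw [← hκ]
    ring
  linarith

open Classical in
/-- The pairs of neighbours of `u`, `v` that cannot be used in a switching. -/
lemma sum_bad_le (h : Sparse d ε) (hS : S.card ≤ 2) {u v : Fin n} (huv : u ≠ v) :
    ((∑ G ∈ containing d S, (Finset.univ.filter fun p : Fin n × Fin n =>
        (G.Adj u p.1 ∧ s(u, p.1) ∉ S) ∧ (G.Adj v p.2 ∧ s(v, p.2) ∉ S) ∧
        ¬ G.Adj u v ∧ (p.1 = p.2 ∨ G.Adj p.1 p.2)).card : ℕ) : ℝ) ≤
      28 * ε * ((d u - degIn S u : ℕ) * (d v - degIn S v : ℕ) * (containing d S).card) := by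
  have hM := h.M_pos
  have hε := h.eps_pos
  have hle := h.le
  simp only [Finset.card_filter]
  rw [Finset.sum_comm]
  simp only [← Finset.card_filter]
  rw [Nat.cast_sum]
  refine (Finset.sum_le_sum fun p _ => h.card_bad_pair_le hS huv p.1 p.2 rfl rfl rfl rfl).trans ?_
  rw [Finset.sum_add_distrib, Finset.sum_add_distrib, ← Finset.mul_sum, ← Finset.mul_sum,
    ← Finset.mul_sum]
  simp only [mul_assoc (_ ^ _)]
  have hd2 : ∑ x, (d x : ℝ) ^ 2 ≤ maxDeg d * M 1 d := by
    rw [M_one, Nat.cast_sum, Finset.mul_sum]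
    refine Finset.sum_le_sum fun x _ => ?_
    rw [sq]
    have : (d x : ℝ) ≤ maxDeg d := by exact_mod_cast le_maxDeg d x
    gcongr
  have hd0 : 0 ≤ ∑ x, (d x : ℝ) ^ 2 := Finset.sum_nonneg fun _ _ => sq_nonneg _
  have s1 : ∑ p : Fin n × Fin n, (if p.1 = p.2 then (d p.1 : ℝ) ^ 2 else 0) ≤
      maxDeg d * M 1 d := by
    rw [← Finset.univ_product_univ, Finset.sum_product]
    simpa using hd2
  have s2 : ∑ p : Fin n × Fin n, (if s(p.1, p.2) ∈ S then (maxDeg d : ℝ) ^ 2 else 0) ≤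
      4 * (maxDeg d : ℝ) ^ 2 := by
    rw [← Finset.sum_filter, Finset.sum_const, nsmul_eq_mul]
    have := card_filter_mem_sym2_le S
    have : ((Finset.univ.filter fun p : Fin n × Fin n => s(p.1, p.2) ∈ S).card : ℝ) ≤ 4 := by
      exact_mod_cast (by omega)
    gcongr
  have s3 : ∑ p : Fin n × Fin n, ((d p.1 : ℝ) ^ 2 * (d p.2 : ℝ) ^ 2) ≤
      (maxDeg d * M 1 d : ℝ) ^ 2 := by
    rw [← Finset.univ_product_univ, Finset.sum_product]
    dsimp only
    rw [← Finset.sum_mul_sum, ← sq]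
    exact pow_le_pow_left₀ hd0 hd2 2
  have := bad_terms_le (κ := (1 + 28 * ε) / M 1 d) (by positivity)
    (by rw [div_mul_cancel₀ _ hM.ne']; linarith) (by exact_mod_cast h.maxDeg_pos)
    (by exact_mod_cast h.pos) hε h.maxDeg_sq (c := (d u - degIn S u : ℕ) * (d v - degIn S v : ℕ) *
      (containing d S).card) (by positivity) s1 s2 s3
  simpa only [mul_assoc] using this

/-- Lower bound for the number of realizations containing one more edge. -/
lemma le_card_containing_insert (h : Sparse d ε) (hS : S.card ≤ 2) {u v : Fin n} (huv : u ≠ v)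
    {a b : ℕ} (ha : a + degIn S u ≤ d u) (hb : b + degIn S v ≤ d v) :
    (1 - 29 * ε) / M 1 d * (a * b) * (containing d S).card ≤
      ((containing d (insert s(u, v) S)).card : ℝ) := by
  have h1 := card_containing_mul_le (d := d) (S := S) huv
  have h2 := h.sum_bad_le hS huv
  have h3 := (Nat.cast_le (α := ℝ)).2 h1
  rw [Nat.cast_add] at h3
  have h4 := h3.trans (add_le_add le_rfl h2)
  simp only [Nat.cast_mul, Nat.cast_add, Nat.cast_pow] at h4
  have hε := h.eps_pos
  have hM := h.M_pos
  have hle := h.le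
  have hsq := h.maxDeg_sq
  have h5 : (a : ℝ) ≤ (d u - degIn S u : ℕ) := by exact_mod_cast (by omega)
  have h6 : (b : ℝ) ≤ (d v - degIn S v : ℕ) := by exact_mod_cast (by omega)
  set a' : ℝ := ((d u - degIn S u : ℕ) : ℝ)
  set b' : ℝ := ((d v - degIn S v : ℕ) : ℝ)
  set N : ℝ := ((containing d S).card : ℝ)
  set X : ℝ := ((containing d (insert s(u, v) S)).card : ℝ)
  have hX : 0 ≤ X := Nat.cast_nonneg _
  have hN : 0 ≤ N := Nat.cast_nonneg _
  have hab : (a : ℝ) * b * N ≤ a' * b' * N := by gcongr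
  have hab0 : 0 ≤ (a : ℝ) * b * N := by positivity
  have h7 : (1 - 28 * ε) * (a * b * N) ≤ X * M 1 d * (1 + ε) := by
    have : (1 - 28 * ε) * (a * b * N) ≤ (1 - 28 * ε) * (a' * b' * N) :=
      mul_le_mul_of_nonneg_left hab (by linarith)
    have h8 : X * (maxDeg d : ℝ) ^ 2 ≤ X * (ε * M 1 d) := by gcongr
    linarith
  -- The product (1 - 29ε)(1 + ε) equals 1 - 28ε - 29ε². The factor 1 + ε comes from M_1 + Δ² ≤ (1 +
  -- ε) M_1.
  have h8 : (1 - 29 * ε) * (1 + ε) * (a * b * N) ≤ (1 - 28 * ε) * (a * b * N) :=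
    mul_le_mul_of_nonneg_right (by nlinarith) hab0
  have h9 : (1 - 29 * ε) * (a * b * N) ≤ X * M 1 d := by
    have : (1 + ε) * ((1 - 29 * ε) * (a * b * N)) ≤ (1 + ε) * (X * M 1 d) := by linarith
    exact le_of_mul_le_mul_left this (by positivity)
  rw [div_mul_eq_mul_div, div_mul_eq_mul_div, div_le_iff₀ hM]
  linarith

end Sparse

/-! ### Second moments, and cherries on two leaves -/

section

variable {n : ℕ} {d : Fin n → ℕ}

open Classical in
/-- The second moment method for the number of copies of edge sets from a given family. -/
lemma second_moment {ι : Type*} (T : Finset ι) (E : ι → Finset (Sym2 (Fin n)))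
    (Q : SimpleGraph (Fin n) → Prop) (hQ : ∀ t ∈ T, ∀ G ∈ containing d (E t), Q G) :
    (∑ t ∈ T, ((containing d (E t)).card : ℝ)) ^ 2 ≤ ((realizations d).filter Q).card *
      ∑ t ∈ T, ∑ t' ∈ T,
        (((containing d (E t)).filter fun G => G ∈ containing d (E t')).card : ℝ) := by
  set X : SimpleGraph (Fin n) → ℝ := fun G =>
    ∑ t ∈ T, if G ∈ containing d (E t) then 1 else 0 with hX
  have hinter : ∀ t, (realizations d).filter (fun G => G ∈ containing d (E t)) =
      containing d (E t) := fun t => by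
    rw [Finset.filter_mem_eq_inter, Finset.inter_eq_right.2 containing_subset]
  have hcard : ∀ t, ((containing d (E t)).card : ℝ) =
      ∑ G ∈ realizations d, if G ∈ containing d (E t) then 1 else 0 := by
    intro t
    rw [← Finset.sum_filter, hinter]
    simp
  have hcard2 : ∀ t t', (((containing d (E t)).filter fun G => G ∈ containing d (E t')).card : ℝ) =
      ∑ G ∈ realizations d, (if G ∈ containing d (E t) then 1 else 0) *
        (if G ∈ containing d (E t') then 1 else 0) := by
    intro t t'
    simp only [ite_mul, one_mul, zero_mul]
    rw [← Finset.sum_filter, hinter, Finset.card_filter]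
    push_cast
    rfl
  have h1 : ∑ t ∈ T, ((containing d (E t)).card : ℝ) =
      ∑ G ∈ (realizations d).filter Q, X G := by
    simp only [hcard]
    rw [Finset.sum_comm, Finset.sum_filter]
    refine Finset.sum_congr rfl fun G _ => ?_
    split_ifs with hG
    · rfl
    · exact Finset.sum_eq_zero fun t ht => if_neg fun h => hG (hQ t ht G h)
  have h2 : ∑ t ∈ T, ∑ t' ∈ T,
      (((containing d (E t)).filter fun G => G ∈ containing d (E t')).card : ℝ) =
      ∑ G ∈ realizations d, X G ^ 2 := by
    simp only [hcard2, hX, sq, Finset.sum_mul_sum]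
    rw [Finset.sum_congr rfl fun t _ => Finset.sum_comm, Finset.sum_comm]
  rw [h1, h2]
  -- The count `X` vanishes on realizations without `Q`, so Cauchy–Schwarz is applied on those with
  -- `Q` only. The sum of squares may then run over all realizations.
  refine sq_sum_le_card_mul_sum_sq.trans ?_
  gcongr
  exact Finset.filter_subset _ _

/-- The edge set of a path with middle vertex `a` and ends `u`, `v`, together with `S`. -/
def addCherry (S : Finset (Sym2 (Fin n))) (a u v : Fin n) : Finset (Sym2 (Fin n)) :=
  insert s(a, v) (insert s(a, u) S)

lemma mem_containing_addCherry {S : Finset (Sym2 (Fin n))} {a u v : Fin n}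
    {G : SimpleGraph (Fin n)} :
    G ∈ containing d (addCherry S a u v) ↔ G ∈ containing d S ∧ G.Adj a u ∧ G.Adj a v := by
  rw [addCherry, mem_containing_insert, mem_containing_insert, and_assoc]

lemma descFactorial_two (k : ℕ) : k.descFactorial 2 = k * (k - 1) := by
  simp [Nat.descFactorial, mul_comm]

lemma card_addCherry_le (S : Finset (Sym2 (Fin n))) (a u v : Fin n) :
    (addCherry S a u v).card ≤ S.card + 2 :=
  (Finset.card_insert_le _ _).trans (Nat.add_le_add_right (Finset.card_insert_le _ _) 1)

/-- The first edge uses up one unit of degree at `a`, so the two edges together contribute d_a (d_a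
- 1), which sums to M_2. -/
lemma Sparse.card_addCherry_le {ε : ℝ} (h : Sparse d ε) {S : Finset (Sym2 (Fin n))}
    (hS : S.card ≤ 4) {a u v : Fin n} (hu : s(a, u) ∉ S) (hv : s(a, v) ∉ S) (huv : u ≠ v) :
    ((containing d (addCherry S a u v)).card : ℝ) ≤ ((1 + 28 * ε) / M 1 d) ^ 2 *
      ((d a).descFactorial 2 * (d u * d v)) * (containing d S).card := by
  have hε := h.eps_pos
  have h1 := h.card_containing_insert_le (by omega) hu (a := d a) (b := d u) (by omega) (by omega)
  have hv' : s(a, v) ∉ insert s(a, u) S := by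
    simp only [Finset.mem_insert, Sym2.eq_iff]; grind
  have h2 := h.card_containing_insert_le ((Finset.card_insert_le _ _).trans (by omega)) hv'
    (a := d a - 1) (b := d v) (by have := degIn_insert_pos hu; omega) (by omega)
  refine h2.trans ((mul_le_mul_of_nonneg_left h1 (by positivity)).trans (le_of_eq ?_))
  rw [descFactorial_two]
  push_cast
  ring

lemma Sparse.le_card_addCherry {ε : ℝ} (h : Sparse d ε) {a u v : Fin n} (hau : a ≠ u)
    (hav : a ≠ v) (huv : u ≠ v) :
    ((1 - 29 * ε) / M 1 d) ^ 2 *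
      ((d a).descFactorial 2 * (d u * d v)) * (realizations d).card ≤
      ((containing d (addCherry ∅ a u v)).card : ℝ) := by
  have hε := h.eps_pos
  have hβ : 0 ≤ (1 - 29 * ε) / M 1 d :=
    div_nonneg (by have := h.le; linarith) (Nat.cast_nonneg _)
  -- If d_a = 0, the truncated `d a - 1` is no longer one below `d a`, as the second edge needs; the
  -- claim is trivial then.
  rcases Nat.eq_zero_or_pos (d a) with h0 | h0
  · simp [h0]
  have h1 := h.le_card_containing_insert (S := ∅) (by simp) hau (a := d a) (b := d u)
    (by simp [degIn_empty]) (by simp [degIn_empty])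
  have h2 := h.le_card_containing_insert (S := insert s(a, u) ∅) (by simp) hav
    (a := d a - 1) (b := d v) (by have := degIn_insert_le ∅ a a u; rw [degIn_empty] at this; omega)
    (by rw [degIn_insert_of_ne _ hav.symm huv.symm, degIn_empty]; omega)
  refine le_trans (le_trans (le_of_eq ?_) (mul_le_mul_of_nonneg_left h1
    (mul_nonneg hβ (by positivity)))) h2
  rw [descFactorial_two, containing_empty]
  push_cast
  ring

lemma eq_of_adj_of_degree_one {G : SimpleGraph (Fin n)} (hG : G ∈ realizations d) {u x y : Fin n}
    (hu : d u = 1) (hx : G.Adj u x) (hy : G.Adj u y) : x = y := by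
  classical
  have h := mem_realizations.1 hG u
  rw [hu] at h
  exact Finset.card_le_one.1 h.le _ (by simpa using hx) _ (by simpa using hy)

/-- The vertices of prescribed degree `k`. -/
def withDegree (d : Fin n → ℕ) (k : ℕ) : Finset (Fin n) := Finset.univ.filter fun i => d i = k

lemma mem_withDegree {k : ℕ} {i : Fin n} : i ∈ withDegree d k ↔ d i = k := by simp [withDegree]

lemma card_withDegree (k : ℕ) : (withDegree d k).card = count k d := rfl

/-- The triples `(a, u, v)` with distinct leaves `u`, `v` and `a` not a leaf. -/
def cherryIndex (d : Fin n → ℕ) : Finset (Fin n × Fin n × Fin n) :=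
  (Finset.univ.filter fun a => 2 ≤ d a) ×ˢ (withDegree d 1).offDiag

lemma mem_cherryIndex {t : Fin n × Fin n × Fin n} : t ∈ cherryIndex d ↔
    2 ≤ d t.1 ∧ d t.2.1 = 1 ∧ d t.2.2 = 1 ∧ t.2.1 ≠ t.2.2 := by
  simp [cherryIndex, mem_withDegree]

lemma sum_cherryIndex : ∑ t ∈ cherryIndex d, ((d t.1).descFactorial 2 : ℝ) =
    M 2 d * (count 1 d * (count 1 d - 1)) := by
  rw [cherryIndex, Finset.sum_product]
  simp only [Finset.sum_const, nsmul_eq_mul]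
  rw [← Finset.mul_sum, Finset.offDiag_card, card_withDegree,
    Nat.cast_sub (Nat.le_mul_self _), mul_comm]
  congr 1
  · rw [M, Nat.cast_sum, Finset.sum_filter]
    refine Finset.sum_congr rfl fun a _ => ?_
    split_ifs with h
    · rfl
    · rw [Nat.descFactorial_eq_zero_iff_lt.2 (by omega)]; simp
  · push_cast; ring

lemma isSymmetric_of_cherry {t : Fin n × Fin n × Fin n} (ht : t ∈ cherryIndex d)
    {G : SimpleGraph (Fin n)} (hG : G ∈ containing d (addCherry ∅ t.1 t.2.1 t.2.2)) :
    IsSymmetric G := by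
  obtain ⟨-, h1, h2, h3⟩ := mem_cherryIndex.1 ht
  obtain ⟨hR, hu, hv⟩ := mem_containing_addCherry.1 hG
  rw [containing_empty] at hR
  refine isSymmetric_of_twins h3 fun w _ _ => ⟨fun h => ?_, fun h => ?_⟩
  · rw [eq_of_adj_of_degree_one hR h1 h hu.symm]; exact hv.symm
  · rw [eq_of_adj_of_degree_one hR h2 h hv.symm]; exact hu.symm

lemma descFactorial_two_le_M_two (a : Fin n) : (d a).descFactorial 2 ≤ M 2 d :=
  Finset.single_le_sum (f := fun i => (d i).descFactorial 2) (fun _ _ => Nat.zero_le _)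
    (Finset.mem_univ a)

/-- This expresses the degree of a cherry's centre through M_2, so that overlapping cherries are
controlled by s alone. -/
lemma sub_one_le_sqrt_M_two (a : Fin n) : ((d a - 1 : ℕ) : ℝ) ≤ √(M 2 d : ℝ) := by
  refine Real.le_sqrt_of_sq_le ?_
  have h := descFactorial_two_le_M_two (d := d) a
  rw [descFactorial_two] at h
  have h2 : (d a - 1) ^ 2 ≤ d a * (d a - 1) := by
    rw [sq]; exact Nat.mul_le_mul_right _ (Nat.sub_le _ _)
  exact_mod_cast h2.trans h

namespace Sparse

variable {ε : ℝ}

-- The centre `t'.1` is not a leaf, so with disjoint leaf pairs all four edges are distinct, even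
-- when the two centres coincide.
open Classical in
lemma cherry_pairs_disjoint (h : Sparse d ε) {t t' : Fin n × Fin n × Fin n}
    (ht : t ∈ cherryIndex d) (ht' : t' ∈ cherryIndex d)
    (h1 : t'.2.1 ≠ t.2.1 ∧ t'.2.1 ≠ t.2.2 ∧ t'.2.2 ≠ t.2.1 ∧ t'.2.2 ≠ t.2.2) :
    (((containing d (addCherry ∅ t.1 t.2.1 t.2.2)).filter fun G =>
      G ∈ containing d (addCherry ∅ t'.1 t'.2.1 t'.2.2)).card : ℝ) ≤
      ((1 + 28 * ε) / M 1 d) ^ 2 * (d t'.1).descFactorial 2 *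
        (containing d (addCherry ∅ t.1 t.2.1 t.2.2)).card := by
  obtain ⟨a, u, v⟩ := t
  obtain ⟨a', u', v'⟩ := t'
  rw [mem_cherryIndex] at ht ht'
  dsimp only at *
  have hne : a' ≠ u ∧ a' ≠ v := by
    constructor <;> (rintro rfl; omega)
  have hsub : ((containing d (addCherry ∅ a u v)).filter fun G =>
      G ∈ containing d (addCherry ∅ a' u' v')) ⊆
      containing d (addCherry (addCherry ∅ a u v) a' u' v') := by
    intro G hG
    obtain ⟨hG1, hG2⟩ := Finset.mem_filter.1 hG
    exact mem_containing_addCherry.2 ⟨hG1, (mem_containing_addCherry.1 hG2).2⟩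
  refine (Nat.cast_le.2 (Finset.card_le_card hsub)).trans ((h.card_addCherry_le
    ((DegSeq.card_addCherry_le _ _ _ _).trans (by simp)) ?_ ?_ ht'.2.2.2).trans (le_of_eq ?_))
  · simp only [addCherry, Finset.mem_insert, Sym2.eq_iff, Finset.notMem_empty]; grind
  · simp only [addCherry, Finset.mem_insert, Sym2.eq_iff, Finset.notMem_empty]; grind
  · rw [ht'.2.1, ht'.2.2.1]; simp

-- The leaves u and v account for 2. Any other leaf is joined to `a` with conditional probability at
-- most κ(d_a - 1) ≤ κ√M_2.
open Classical in
lemma sum_nbr_leaves_le (h : Sparse d ε) {a u v : Fin n} (ht : (a, u, v) ∈ cherryIndex d) :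
    ∑ G ∈ containing d (addCherry ∅ a u v),
      (((withDegree d 1).filter fun w => G.Adj a w).card : ℝ) ≤
      (2 + count 1 d * ((1 + 28 * ε) / M 1 d * √(M 2 d : ℝ))) *
        (containing d (addCherry ∅ a u v)).card := by
  set N : ℝ := ((containing d (addCherry ∅ a u v)).card : ℝ) with hN
  have hε := h.eps_pos
  rw [mem_cherryIndex] at ht
  dsimp only at ht
  have hne : a ≠ u ∧ a ≠ v := by
    constructor <;> (rintro rfl; omega)
  simp only [Finset.card_filter]
  push_cast
  rw [Finset.sum_comm]
  have step : ∀ w ∈ withDegree d 1, (∑ G ∈ containing d (addCherry ∅ a u v),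
      if G.Adj a w then (1 : ℝ) else 0) ≤ (if w ∈ ({u, v} : Finset (Fin n)) then N else 0) +
        (1 + 28 * ε) / M 1 d * √(M 2 d : ℝ) * N := by
    intro w hw
    have hp : 0 ≤ (1 + 28 * ε) / M 1 d * √(M 2 d : ℝ) * N := by positivity
    split_ifs with hwuv
    · have : (∑ G ∈ containing d (addCherry ∅ a u v), if G.Adj a w then (1 : ℝ) else 0) ≤
          ∑ G ∈ containing d (addCherry ∅ a u v), (1 : ℝ) :=
        Finset.sum_le_sum fun G _ => by split_ifs <;> norm_num
      rw [Finset.sum_const, nsmul_eq_mul, mul_one] at this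
      linarith
    · rw [← Finset.sum_filter, Finset.sum_const, nsmul_eq_mul, mul_one]
      have hsub : (containing d (addCherry ∅ a u v)).filter (fun G => G.Adj a w) ⊆
          containing d (insert s(a, w) (addCherry ∅ a u v)) := by
        intro G hG
        exact mem_containing_insert.2 (Finset.mem_filter.1 hG)
      have hnot : s(a, w) ∉ addCherry ∅ a u v := by
        simp only [Finset.mem_insert, Finset.mem_singleton] at hwuv
        simp only [addCherry, Finset.mem_insert, Sym2.eq_iff, Finset.notMem_empty]; grind
      have hdeg : 1 ≤ degIn (addCherry ∅ a u v) a :=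
        (Nat.le_add_left _ _).trans ((degIn_insert_pos (S := ∅) (u := a) (x := u)
          (by simp)).trans (degIn_mono (Finset.subset_insert _ _) a))
      have h3 := h.card_containing_insert_le
        ((DegSeq.card_addCherry_le _ _ _ _).trans (by simp)) hnot (a := d a - 1) (b := 1)
        (by omega) (by rw [mem_withDegree.1 hw]; omega)
      rw [zero_add]
      refine (Nat.cast_le.2 (Finset.card_le_card hsub)).trans (h3.trans ?_)
      have := sub_one_le_sqrt_M_two (d := d) a
      rw [Nat.cast_one, mul_one]
      gcongr
  refine (Finset.sum_le_sum step).trans ?_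
  rw [Finset.sum_add_distrib, Finset.sum_const, card_withDegree, nsmul_eq_mul, add_mul]
  refine add_le_add ?_ (le_of_eq (by ring))
  rw [← Finset.sum_filter, Finset.sum_const, nsmul_eq_mul]
  have : ((withDegree d 1).filter fun w => w ∈ ({u, v} : Finset (Fin n))).card ≤ 2 :=
    (Finset.card_le_card (fun w hw => (Finset.mem_filter.1 hw).2)).trans
      (Finset.card_le_two (a := u) (b := v))
  have : (((withDegree d 1).filter fun w => w ∈ ({u, v} : Finset (Fin n))).card : ℝ) ≤ 2 := by
    exact_mod_cast this
  gcongr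

-- A shared leaf has only one neighbour, so both cherries have the same centre and all leaves
-- involved hang from it. One of two positions holds one of two shared leaves and the other is any
-- leaf at the centre, which gives the factor 4.
open Classical in
lemma cherry_pairs_overlap (h : Sparse d ε) {t : Fin n × Fin n × Fin n}
    (ht : t ∈ cherryIndex d) :
    ∑ t' ∈ (cherryIndex d).filter (fun t' =>
      ¬ (t'.2.1 ≠ t.2.1 ∧ t'.2.1 ≠ t.2.2 ∧ t'.2.2 ≠ t.2.1 ∧ t'.2.2 ≠ t.2.2)),
      (((containing d (addCherry ∅ t.1 t.2.1 t.2.2)).filter fun G =>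
      G ∈ containing d (addCherry ∅ t'.1 t'.2.1 t'.2.2)).card : ℝ) ≤
      4 * (2 + count 1 d * ((1 + 28 * ε) / M 1 d * √(M 2 d : ℝ))) *
        (containing d (addCherry ∅ t.1 t.2.1 t.2.2)).card := by
  obtain ⟨a, u, v⟩ := t
  have h1 := h.sum_nbr_leaves_le ht
  dsimp only
  simp only [Finset.card_filter _ (containing _ _)]
  push_cast
  rw [Finset.sum_comm, mul_assoc]
  refine le_trans ?_ (mul_le_mul_of_nonneg_left h1 (by norm_num))
  rw [Finset.mul_sum]
  refine Finset.sum_le_sum fun G hG => ?_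
  rw [← Finset.sum_filter, Finset.sum_const, nsmul_eq_mul, mul_one]
  set W := (withDegree d 1).filter fun w => G.Adj a w with hW
  obtain ⟨hR, hau, hav⟩ := mem_containing_addCherry.1 hG
  rw [containing_empty] at hR
  rw [mem_cherryIndex] at ht
  dsimp only at ht
  refine le_trans (Nat.cast_le.2 (Finset.card_le_card
    (t := ({a} ×ˢ ({u, v} ×ˢ W)) ∪ ({a} ×ˢ (W ×ˢ {u, v}))) ?_)) ?_
  · rintro ⟨a', u', v'⟩ ht'
    simp only [Finset.mem_filter, mem_cherryIndex] at ht'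
    obtain ⟨⟨⟨h2, h3, h4, h5⟩, h6⟩, h7⟩ := ht'
    obtain ⟨-, hau', hav'⟩ := mem_containing_addCherry.1 h7
    have haa : a' = a := by
      by_cases c1 : u' = u
      · subst c1; exact eq_of_adj_of_degree_one hR h3 hau'.symm hau.symm
      by_cases c2 : u' = v
      · subst c2; exact eq_of_adj_of_degree_one hR h3 hau'.symm hav.symm
      by_cases c3 : v' = u
      · subst c3; exact eq_of_adj_of_degree_one hR h4 hav'.symm hau.symm
      by_cases c4 : v' = v
      · subst c4; exact eq_of_adj_of_degree_one hR h4 hav'.symm hav.symm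
      exact absurd ⟨c1, c2, c3, c4⟩ h6
    subst haa
    simp only [hW, Finset.mem_union, Finset.mem_product, Finset.mem_singleton, Finset.mem_insert,
      Finset.mem_filter, mem_withDegree, true_and]
    have h8 : (u' = u ∨ u' = v) ∨ (v' = u ∨ v' = v) := by
      by_contra hc
      push Not at hc
      exact h6 ⟨hc.1.1, hc.1.2, hc.2.1, hc.2.2⟩
    rcases h8 with h8 | h8
    · exact Or.inl ⟨h8, h4, hav'⟩
    · exact Or.inr ⟨⟨h3, hau'⟩, h8⟩
  · have h9 : (({a} ×ˢ ({u, v} ×ˢ W)) ∪ ({a} ×ˢ (W ×ˢ {u, v})) :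
        Finset (Fin n × Fin n × Fin n)).card ≤ 4 * W.card := by
      refine (Finset.card_union_le _ _).trans ?_
      simp only [Finset.card_product, Finset.card_singleton, one_mul]
      have := Finset.card_le_two (a := u) (b := v)
      nlinarith
    exact_mod_cast h9

/-- The second moment bound for pairs of leaves with a common neighbour. -/
theorem cherry_bound (h : Sparse d ε) :
    open Classical in
    (((1 - 29 * ε) / M 1 d) ^ 2 * (M 2 d * (count 1 d * (count 1 d - 1)))) ^ 2 *
      (realizations d).card ^ 2 ≤ ((realizations d).filter IsSymmetric).card *
      ((((1 + 28 * ε) / M 1 d) ^ 4 * (M 2 d * count 1 d ^ 2) ^ 2 +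
      4 * (2 + count 1 d * ((1 + 28 * ε) / M 1 d * √(M 2 d : ℝ))) *
        (((1 + 28 * ε) / M 1 d) ^ 2 * (M 2 d * count 1 d ^ 2))) * (realizations d).card) := by
  classical
  have hε := h.eps_pos
  have hsm := second_moment (d := d) (cherryIndex d) (fun t => addCherry ∅ t.1 t.2.1 t.2.2)
    IsSymmetric fun t ht G hG => isSymmetric_of_cherry ht hG
  have hne : ∀ t ∈ cherryIndex d, t.1 ≠ t.2.1 ∧ t.1 ≠ t.2.2 := by
    rintro ⟨a, u, v⟩ ht
    rw [mem_cherryIndex] at ht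
    dsimp only at *
    constructor <;> (rintro rfl; omega)
  set κ : ℝ := (1 + 28 * ε) / M 1 d with hκ
  have hκ0 : 0 ≤ κ := by positivity
  set N : ℝ := ((realizations d).card : ℝ) with hN
  have hc1 : 0 ≤ (count 1 d : ℝ) * (count 1 d - 1) := by
    rcases Nat.eq_zero_or_pos (count 1 d) with h0 | h0
    · simp [h0]
    · have : (1 : ℝ) ≤ count 1 d := by exact_mod_cast h0
      nlinarith
  have hsum : ∑ t ∈ cherryIndex d, ((d t.1).descFactorial 2 : ℝ) ≤ M 2 d * count 1 d ^ 2 := by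
    rw [sum_cherryIndex]
    gcongr
    nlinarith [(Nat.cast_nonneg (count 1 d) : (0 : ℝ) ≤ count 1 d)]
  have hlow : ((1 - 29 * ε) / M 1 d) ^ 2 * (M 2 d * (count 1 d * (count 1 d - 1))) * N ≤
      ∑ t ∈ cherryIndex d, ((containing d (addCherry ∅ t.1 t.2.1 t.2.2)).card : ℝ) := by
    rw [← sum_cherryIndex, Finset.mul_sum, Finset.sum_mul]
    refine Finset.sum_le_sum fun t ht => ?_
    have h1 := h.le_card_addCherry (hne t ht).1 (hne t ht).2 (mem_cherryIndex.1 ht).2.2.2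
    rw [(mem_cherryIndex.1 ht).2.1, (mem_cherryIndex.1 ht).2.2.1] at h1
    simpa using h1
  have hup : ∀ t ∈ cherryIndex d, ((containing d (addCherry ∅ t.1 t.2.1 t.2.2)).card : ℝ) ≤
      κ ^ 2 * (d t.1).descFactorial 2 * N := by
    intro t ht
    have h1 := h.card_addCherry_le (S := ∅) (a := t.1) (by simp) (by simp) (by simp)
      (mem_cherryIndex.1 ht).2.2.2
    rw [(mem_cherryIndex.1 ht).2.1, (mem_cherryIndex.1 ht).2.2.1, containing_empty] at h1
    simpa using h1
  have hlow2 : (((1 - 29 * ε) / M 1 d) ^ 2 * (M 2 d * (count 1 d * (count 1 d - 1))) * N) ^ 2 ≤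
      (∑ t ∈ cherryIndex d, ((containing d (addCherry ∅ t.1 t.2.1 t.2.2)).card : ℝ)) ^ 2 :=
    pow_le_pow_left₀ (by positivity) hlow 2
  rw [← mul_pow]
  refine hlow2.trans (hsm.trans (mul_le_mul_of_nonneg_left ?_ (Nat.cast_nonneg _)))
  have hrow : ∀ t ∈ cherryIndex d, ∑ t' ∈ cherryIndex d,
      (((containing d (addCherry ∅ t.1 t.2.1 t.2.2)).filter fun G =>
        G ∈ containing d (addCherry ∅ t'.1 t'.2.1 t'.2.2)).card : ℝ) ≤
      (κ ^ 2 * (M 2 d * count 1 d ^ 2) + 4 * (2 + count 1 d * (κ * √(M 2 d : ℝ)))) *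
        (κ ^ 2 * (d t.1).descFactorial 2 * N) := by
    intro t ht
    refine le_trans ?_ (mul_le_mul_of_nonneg_left (hup t ht) (by positivity))
    rw [← Finset.sum_filter_add_sum_filter_not _ (fun t' : Fin n × Fin n × Fin n =>
      t'.2.1 ≠ t.2.1 ∧ t'.2.1 ≠ t.2.2 ∧ t'.2.2 ≠ t.2.1 ∧ t'.2.2 ≠ t.2.2), add_mul]
    refine add_le_add ?_ (h.cherry_pairs_overlap ht)
    refine (Finset.sum_le_sum fun t' ht' => h.cherry_pairs_disjoint ht
      (Finset.mem_filter.1 ht').1 (Finset.mem_filter.1 ht').2).trans ?_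
    rw [← Finset.sum_mul, ← Finset.mul_sum]
    gcongr
    refine le_trans (Finset.sum_le_sum_of_subset_of_nonneg (Finset.filter_subset _ _)
      fun _ _ _ => Nat.cast_nonneg _) hsum
  refine (Finset.sum_le_sum hrow).trans ?_
  rw [← Finset.mul_sum, ← Finset.sum_mul, ← Finset.mul_sum]
  calc _ ≤ (κ ^ 2 * (M 2 d * count 1 d ^ 2) + 4 * (2 + count 1 d * (κ * √(M 2 d : ℝ)))) *
        (κ ^ 2 * (M 2 d * count 1 d ^ 2) * N) := by gcongr
    _ = _ := by ring

end Sparse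

end

/-! ### Triangles with two vertices of degree two -/

section

variable {n : ℕ} {d : Fin n → ℕ}

/-- The edge set of the triangle `a u v` together with `S`. -/
def addTriangle (S : Finset (Sym2 (Fin n))) (a u v : Fin n) : Finset (Sym2 (Fin n)) :=
  insert s(u, v) (addCherry S a u v)

lemma mem_containing_addTriangle {S : Finset (Sym2 (Fin n))} {a u v : Fin n}
    {G : SimpleGraph (Fin n)} :
    G ∈ containing d (addTriangle S a u v) ↔
      G ∈ containing d S ∧ G.Adj a u ∧ G.Adj a v ∧ G.Adj u v := by
  rw [addTriangle, mem_containing_insert, mem_containing_addCherry]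
  tauto

lemma card_addTriangle_le (S : Finset (Sym2 (Fin n))) (a u v : Fin n) :
    (addTriangle S a u v).card ≤ S.card + 3 :=
  (Finset.card_insert_le _ _).trans (Nat.add_le_add_right (card_addCherry_le _ _ _ _) 1)

/-- The cherry contributes 2 · 2 · d_a (d_a - 1). After it, u and v have one unit of degree left
each, so the closing edge costs only a factor κ. -/
lemma Sparse.card_addTriangle_le {ε : ℝ} (h : Sparse d ε) {S : Finset (Sym2 (Fin n))}
    (hS : S.card ≤ 3) {a u v : Fin n} (hu : s(a, u) ∉ S) (hv : s(a, v) ∉ S) (huvS : s(u, v) ∉ S)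
    (hau : a ≠ u) (hav : a ≠ v) (huv : u ≠ v) (hdu : d u = 2) (hdv : d v = 2) :
    ((containing d (addTriangle S a u v)).card : ℝ) ≤ ((1 + 28 * ε) / M 1 d) ^ 3 *
      (4 * (d a).descFactorial 2) * (containing d S).card := by
  have hε := h.eps_pos
  have h1 := h.card_addCherry_le (by omega) hu hv huv
  have hnot : s(u, v) ∉ addCherry S a u v := by
    simp only [addCherry, Finset.mem_insert, Sym2.eq_iff]; grind
  have hne : s(a, v) ∉ insert s(a, u) S := by
    simp only [Finset.mem_insert, Sym2.eq_iff]; grind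
  have du : 1 ≤ degIn (addCherry S a u v) u := by
    rw [Sym2.eq_swap] at hu
    refine le_trans (le_trans (Nat.le_add_left _ _) (degIn_insert_pos hu))
      (degIn_mono ?_ u)
    rw [Sym2.eq_swap]
    exact Finset.subset_insert _ _
  have dv : 1 ≤ degIn (addCherry S a u v) v := by
    have e : s(v, a) = s(a, v) := Sym2.eq_swap
    rw [← e] at hne
    refine le_trans (le_trans (Nat.le_add_left _ _) (degIn_insert_pos hne)) (degIn_mono ?_ v)
    rw [e]
    exact Finset.Subset.refl _
  have h2 := h.card_containing_insert_le ((DegSeq.card_addCherry_le _ _ _ _).trans (by omega)) hnot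
    (a := 1) (b := 1) (by omega) (by omega)
  refine h2.trans ((mul_le_mul_of_nonneg_left h1 (by positivity)).trans (le_of_eq ?_))
  rw [hdu, hdv]
  push_cast
  ring

lemma Sparse.le_card_addTriangle {ε : ℝ} (h : Sparse d ε) {a u v : Fin n} (hau : a ≠ u)
    (hav : a ≠ v) (huv : u ≠ v) (hdu : d u = 2) (hdv : d v = 2) :
    ((1 - 29 * ε) / M 1 d) ^ 3 * (4 * (d a).descFactorial 2) * (realizations d).card ≤
      ((containing d (addTriangle ∅ a u v)).card : ℝ) := by
  have hβ : 0 ≤ (1 - 29 * ε) / M 1 d :=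
    div_nonneg (by have := h.le; linarith) (Nat.cast_nonneg _)
  have h1 := h.le_card_addCherry hau hav huv
  have du : degIn (addCherry ∅ a u v) u ≤ 1 := by
    rw [addCherry, degIn_insert_of_ne _ hau.symm huv]
    have := degIn_insert_le ∅ u a u
    rwa [degIn_empty] at this
  have dv : degIn (addCherry ∅ a u v) v ≤ 1 := by
    have h2 := degIn_insert_le (insert s(a, u) ∅) v a v
    rwa [degIn_insert_of_ne _ hav.symm huv.symm, degIn_empty] at h2
  have h2 := h.le_card_containing_insert (S := addCherry ∅ a u v)
    ((DegSeq.card_addCherry_le _ _ _ _).trans (by simp)) huv (a := 1) (b := 1)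
    (by omega) (by omega)
  refine le_trans (le_trans (le_of_eq ?_) (mul_le_mul_of_nonneg_left h1
    (mul_nonneg hβ (by positivity)))) h2
  rw [hdu, hdv]
  push_cast
  ring

lemma eq_or_eq_of_adj_of_degree_two {G : SimpleGraph (Fin n)} (hG : G ∈ realizations d)
    {u x y z : Fin n} (hu : d u = 2) (hx : G.Adj u x) (hy : G.Adj u y) (hxy : x ≠ y)
    (hz : G.Adj u z) : z = x ∨ z = y := by
  classical
  have h := mem_realizations.1 hG u
  by_contra hc
  push Not at hc
  have h3 : ({z, x, y} : Finset (Fin n)) ⊆ Finset.univ.filter fun j => G.Adj u j := by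
    intro w
    simp only [Finset.mem_insert, Finset.mem_singleton, Finset.mem_filter, Finset.mem_univ,
      true_and]
    rintro (rfl | rfl | rfl) <;> assumption
  have h4 := Finset.card_le_card h3
  rw [h, hu, Finset.card_eq_three.2 ⟨z, x, y, hc.1, hc.2, hxy, rfl⟩] at h4
  omega

/-- The triples `(a, u, v)` of distinct vertices with `u`, `v` of degree two. -/
def triangleIndex (d : Fin n → ℕ) : Finset (Fin n × Fin n × Fin n) :=
  (Finset.univ ×ˢ (withDegree d 2).offDiag).filter fun t => t.1 ≠ t.2.1 ∧ t.1 ≠ t.2.2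

lemma mem_triangleIndex {t : Fin n × Fin n × Fin n} : t ∈ triangleIndex d ↔
    d t.2.1 = 2 ∧ d t.2.2 = 2 ∧ t.2.1 ≠ t.2.2 ∧ t.1 ≠ t.2.1 ∧ t.1 ≠ t.2.2 := by
  simp [triangleIndex, mem_withDegree, and_assoc]

lemma sum_triangleIndex_le :
    ∑ t ∈ triangleIndex d, ((d t.1).descFactorial 2 : ℝ) ≤ M 2 d * count 2 d ^ 2 := by
  refine (Finset.sum_le_sum_of_subset_of_nonneg (Finset.filter_subset _ _)
    fun _ _ _ => Nat.cast_nonneg _).trans ?_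
  rw [Finset.sum_product]
  simp only [Finset.sum_const, nsmul_eq_mul]
  rw [← Finset.mul_sum, mul_comm, M, Nat.cast_sum]
  gcongr
  rw [Finset.offDiag_card, card_withDegree, ← sq]
  exact_mod_cast Nat.sub_le _ _

/-- The apex may itself have degree two. Removing it leaves at least n_2 - 1 candidates for the
ordered pair. -/
lemma le_sum_triangleIndex (h2 : 2 ≤ count 2 d) :
    M 2 d * ((count 2 d - 1) * (count 2 d - 2) : ℝ) ≤
      ∑ t ∈ triangleIndex d, ((d t.1).descFactorial 2 : ℝ) := by
  rw [triangleIndex, Finset.sum_filter, Finset.sum_product, M, Nat.cast_sum, Finset.sum_mul]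
  refine Finset.sum_le_sum fun a _ => ?_
  dsimp only
  rw [← Finset.sum_filter, Finset.sum_const, nsmul_eq_mul, mul_comm]
  gcongr
  have hsub : ((withDegree d 2).erase a).offDiag ⊆
      (withDegree d 2).offDiag.filter fun p => a ≠ p.1 ∧ a ≠ p.2 := by
    intro p
    simp only [Finset.mem_offDiag, Finset.mem_erase, Finset.mem_filter]
    tauto
  refine le_trans ?_ (Nat.cast_le.2 (Finset.card_le_card hsub))
  rw [Finset.offDiag_card, Nat.cast_sub (Nat.le_mul_self _)]
  push_cast
  have h3 : (withDegree d 2).card - 1 ≤ ((withDegree d 2).erase a).card := Finset.pred_card_le_card_erase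
  rw [card_withDegree] at h3
  have h4 : (count 2 d : ℝ) - 1 ≤ (((withDegree d 2).erase a).card : ℝ) := by
    rw [sub_le_iff_le_add]
    exact_mod_cast (by omega : count 2 d ≤ ((withDegree d 2).erase a).card + 1)
  have h5 : (2 : ℝ) ≤ count 2 d := by exact_mod_cast h2
  nlinarith

lemma isSymmetric_of_triangle {t : Fin n × Fin n × Fin n} (ht : t ∈ triangleIndex d)
    {G : SimpleGraph (Fin n)} (hG : G ∈ containing d (addTriangle ∅ t.1 t.2.1 t.2.2)) :
    IsSymmetric G := by
  obtain ⟨h1, h2, h3, h4, h5⟩ := mem_triangleIndex.1 ht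
  obtain ⟨hR, hu, hv, huv⟩ := mem_containing_addTriangle.1 hG
  rw [containing_empty] at hR
  refine isSymmetric_of_twins h3 fun w hwu hwv => ⟨fun h => ?_, fun h => ?_⟩
  · rcases eq_or_eq_of_adj_of_degree_two hR h1 hu.symm huv h5 h with rfl | rfl
    · exact hv.symm
    · exact absurd rfl hwv
  · rcases eq_or_eq_of_adj_of_degree_two hR h2 hv.symm huv.symm h4 h with rfl | rfl
    · exact hu.symm
    · exact absurd rfl hwu

namespace Sparse

variable {ε : ℝ}

-- If the apex of one triangle were a degree-two vertex of the other, its two neighbours would be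
-- the degree-two vertices of the first, contradicting disjointness. Otherwise the six edges are
-- distinct.
open Classical in
lemma triangle_pairs_disjoint (h : Sparse d ε) {t t' : Fin n × Fin n × Fin n}
    (ht : t ∈ triangleIndex d) (ht' : t' ∈ triangleIndex d)
    (h1 : t'.2.1 ≠ t.2.1 ∧ t'.2.1 ≠ t.2.2 ∧ t'.2.2 ≠ t.2.1 ∧ t'.2.2 ≠ t.2.2) :
    (((containing d (addTriangle ∅ t.1 t.2.1 t.2.2)).filter fun G =>
      G ∈ containing d (addTriangle ∅ t'.1 t'.2.1 t'.2.2)).card : ℝ) ≤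
      ((1 + 28 * ε) / M 1 d) ^ 3 * (4 * (d t'.1).descFactorial 2) *
        (containing d (addTriangle ∅ t.1 t.2.1 t.2.2)).card := by
  have hε := h.eps_pos
  obtain ⟨a, u, v⟩ := t
  obtain ⟨a', u', v'⟩ := t'
  rw [mem_triangleIndex] at ht ht'
  dsimp only at *
  set F := (containing d (addTriangle ∅ a u v)).filter fun G =>
      G ∈ containing d (addTriangle ∅ a' u' v') with hF
  rcases F.eq_empty_or_nonempty with h0 | ⟨G, hG⟩
  · rw [h0, Finset.card_empty, Nat.cast_zero]
    positivity
  have hne : a' ≠ u ∧ a' ≠ v := by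
    obtain ⟨hG1, hG2⟩ := Finset.mem_filter.1 hG
    obtain ⟨hR, hau, hav, huv⟩ := mem_containing_addTriangle.1 hG1
    obtain ⟨-, hau', hav', huv'⟩ := mem_containing_addTriangle.1 hG2
    rw [containing_empty] at hR
    constructor
    · rintro rfl
      have := eq_or_eq_of_adj_of_degree_two hR ht.1 hau' hav' ht'.2.2.1 huv
      tauto
    · rintro rfl
      have := eq_or_eq_of_adj_of_degree_two hR ht.2.1 hau' hav' ht'.2.2.1 huv.symm
      tauto
  have hsub : F ⊆ containing d (addTriangle (addTriangle ∅ a u v) a' u' v') := by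
    intro G hG
    obtain ⟨hG1, hG2⟩ := Finset.mem_filter.1 hG
    exact mem_containing_addTriangle.2 ⟨hG1, (mem_containing_addTriangle.1 hG2).2⟩
  refine (Nat.cast_le.2 (Finset.card_le_card hsub)).trans (h.card_addTriangle_le
    ((DegSeq.card_addTriangle_le _ _ _ _).trans (by simp)) ?_ ?_ ?_ ht'.2.2.2.1 ht'.2.2.2.2
    ht'.2.2.1 ht'.1 ht'.2.1)
  all_goals
    simp only [addTriangle, addCherry, Finset.mem_insert, Sym2.eq_iff, Finset.notMem_empty]
    grind

-- A degree-two vertex of a triangle has both its neighbours there, so any triangle through it lies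
-- on the same three vertices. There are 3³ = 27 triples on these.
open Classical in
lemma triangle_pairs_overlap {t : Fin n × Fin n × Fin n} (ht : t ∈ triangleIndex d) :
    ∑ t' ∈ (triangleIndex d).filter (fun t' =>
      ¬ (t'.2.1 ≠ t.2.1 ∧ t'.2.1 ≠ t.2.2 ∧ t'.2.2 ≠ t.2.1 ∧ t'.2.2 ≠ t.2.2)),
      (((containing d (addTriangle ∅ t.1 t.2.1 t.2.2)).filter fun G =>
      G ∈ containing d (addTriangle ∅ t'.1 t'.2.1 t'.2.2)).card : ℝ) ≤
      27 * (containing d (addTriangle ∅ t.1 t.2.1 t.2.2)).card := by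
  obtain ⟨a, u, v⟩ := t
  rw [mem_triangleIndex] at ht
  dsimp only at *
  simp only [Finset.card_filter _ (containing _ _)]
  push_cast
  rw [Finset.sum_comm, mul_comm, ← nsmul_eq_mul]
  refine Finset.sum_le_card_nsmul _ _ _ fun G hG => ?_
  rw [← Finset.sum_filter, Finset.sum_const, nsmul_eq_mul, mul_one]
  obtain ⟨hR, hau, hav, huv⟩ := mem_containing_addTriangle.1 hG
  rw [containing_empty] at hR
  set A : Finset (Fin n) := {a, u, v} with hA
  have hnu : ∀ w, G.Adj u w → w ∈ A := fun w hw => by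
    have := eq_or_eq_of_adj_of_degree_two hR ht.1 hau.symm huv ht.2.2.2.2 hw
    simp only [hA, Finset.mem_insert, Finset.mem_singleton]
    tauto
  have hnv : ∀ w, G.Adj v w → w ∈ A := fun w hw => by
    have := eq_or_eq_of_adj_of_degree_two hR ht.2.1 hav.symm huv.symm ht.2.2.2.1 hw
    simp only [hA, Finset.mem_insert, Finset.mem_singleton]
    tauto
  have huA : u ∈ A := by simp [hA]
  have hvA : v ∈ A := by simp [hA]
  have hsub : (((triangleIndex d).filter (fun t' =>
      ¬ (t'.2.1 ≠ u ∧ t'.2.1 ≠ v ∧ t'.2.2 ≠ u ∧ t'.2.2 ≠ v))).filter fun t' =>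
      G ∈ containing d (addTriangle ∅ t'.1 t'.2.1 t'.2.2)) ⊆ A ×ˢ (A ×ˢ A) := by
    rintro ⟨a', u', v'⟩ ht'
    simp only [Finset.mem_filter] at ht'
    obtain ⟨⟨-, h6⟩, h7⟩ := ht'
    obtain ⟨-, hau', hav', huv'⟩ := mem_containing_addTriangle.1 h7
    simp only [Finset.mem_product]
    by_cases c1 : u' = u
    · subst c1; exact ⟨hnu _ hau'.symm, huA, hnu _ huv'⟩
    by_cases c2 : u' = v
    · subst c2; exact ⟨hnv _ hau'.symm, hvA, hnv _ huv'⟩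
    by_cases c3 : v' = u
    · subst c3; exact ⟨hnu _ hav'.symm, hnu _ huv'.symm, huA⟩
    by_cases c4 : v' = v
    · subst c4; exact ⟨hnv _ hav'.symm, hnv _ huv'.symm, hvA⟩
    exact absurd ⟨c1, c2, c3, c4⟩ h6
  have h9 := Finset.card_le_card hsub
  have hA3 : A.card ≤ 3 := Finset.card_le_three
  rw [Finset.card_product, Finset.card_product] at h9
  have h10 : A.card * (A.card * A.card) ≤ 3 * (3 * 3) := by gcongr
  exact_mod_cast h9.trans h10

/-- The second moment bound for pairs of adjacent vertices of degree two in a common triangle. -/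
theorem triangle_bound (h : Sparse d ε) (h2 : 2 ≤ count 2 d) :
    open Classical in
    (((1 - 29 * ε) / M 1 d) ^ 3 * (4 * (M 2 d * ((count 2 d - 1) * (count 2 d - 2))))) ^ 2 *
      (realizations d).card ^ 2 ≤ ((realizations d).filter IsSymmetric).card *
      ((((1 + 28 * ε) / M 1 d) ^ 6 * (16 * (M 2 d * count 2 d ^ 2) ^ 2) +
        27 * (((1 + 28 * ε) / M 1 d) ^ 3 * (4 * (M 2 d * count 2 d ^ 2)))) *
          (realizations d).card) := by
  classical
  have hε := h.eps_pos
  have hβ : 0 ≤ (1 - 29 * ε) / M 1 d :=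
    div_nonneg (by have := h.le; linarith) (Nat.cast_nonneg _)
  have hsm := second_moment (d := d) (triangleIndex d) (fun t => addTriangle ∅ t.1 t.2.1 t.2.2)
    IsSymmetric fun t ht G hG => isSymmetric_of_triangle ht hG
  set κ : ℝ := (1 + 28 * ε) / M 1 d with hκ
  have hκ0 : 0 ≤ κ := by positivity
  set N : ℝ := ((realizations d).card : ℝ) with hN
  have hc1 : 0 ≤ ((count 2 d : ℝ) - 1) * (count 2 d - 2) := by
    have : (2 : ℝ) ≤ count 2 d := by exact_mod_cast h2
    nlinarith
  have hsum := sum_triangleIndex_le (d := d)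
  have hlow : ((1 - 29 * ε) / M 1 d) ^ 3 * (4 * (M 2 d * ((count 2 d - 1) * (count 2 d - 2)))) * N ≤
      ∑ t ∈ triangleIndex d, ((containing d (addTriangle ∅ t.1 t.2.1 t.2.2)).card : ℝ) := by
    refine le_trans (b := ((1 - 29 * ε) / M 1 d) ^ 3 * (4 * ∑ t ∈ triangleIndex d,
      ((d t.1).descFactorial 2 : ℝ)) * N) ?_ ?_
    · have := le_sum_triangleIndex h2
      gcongr
    rw [Finset.mul_sum, Finset.mul_sum, Finset.sum_mul]
    refine Finset.sum_le_sum fun t ht => ?_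
    obtain ⟨e1, e2, e3, e4, e5⟩ := mem_triangleIndex.1 ht
    exact h.le_card_addTriangle e4 e5 e3 e1 e2
  have hup : ∀ t ∈ triangleIndex d,
      ((containing d (addTriangle ∅ t.1 t.2.1 t.2.2)).card : ℝ) ≤
      κ ^ 3 * (4 * (d t.1).descFactorial 2) * N := by
    intro t ht
    obtain ⟨e1, e2, e3, e4, e5⟩ := mem_triangleIndex.1 ht
    have h1 := h.card_addTriangle_le (S := ∅) (a := t.1) (by simp) (by simp) (by simp) (by simp)
      e4 e5 e3 e1 e2
    rwa [containing_empty] at h1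
  have hlow2 : (((1 - 29 * ε) / M 1 d) ^ 3 *
      (4 * (M 2 d * ((count 2 d - 1) * (count 2 d - 2)))) * N) ^ 2 ≤
      (∑ t ∈ triangleIndex d, ((containing d (addTriangle ∅ t.1 t.2.1 t.2.2)).card : ℝ)) ^ 2 :=
    pow_le_pow_left₀ (by positivity) hlow 2
  rw [← mul_pow]
  refine hlow2.trans (hsm.trans (mul_le_mul_of_nonneg_left ?_ (Nat.cast_nonneg _)))
  have hrow : ∀ t ∈ triangleIndex d, ∑ t' ∈ triangleIndex d,
      (((containing d (addTriangle ∅ t.1 t.2.1 t.2.2)).filter fun G =>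
        G ∈ containing d (addTriangle ∅ t'.1 t'.2.1 t'.2.2)).card : ℝ) ≤
      (κ ^ 3 * (4 * (M 2 d * count 2 d ^ 2)) + 27) *
        (κ ^ 3 * (4 * (d t.1).descFactorial 2) * N) := by
    intro t ht
    refine le_trans ?_ (mul_le_mul_of_nonneg_left (hup t ht) (by positivity))
    rw [← Finset.sum_filter_add_sum_filter_not _ (fun t' : Fin n × Fin n × Fin n =>
      t'.2.1 ≠ t.2.1 ∧ t'.2.1 ≠ t.2.2 ∧ t'.2.2 ≠ t.2.1 ∧ t'.2.2 ≠ t.2.2), add_mul]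
    refine add_le_add ?_ (triangle_pairs_overlap ht)
    refine (Finset.sum_le_sum fun t' ht' => h.triangle_pairs_disjoint ht
      (Finset.mem_filter.1 ht').1 (Finset.mem_filter.1 ht').2).trans ?_
    rw [← Finset.sum_mul, ← Finset.mul_sum, ← Finset.mul_sum]
    gcongr
    exact le_trans (Finset.sum_le_sum_of_subset_of_nonneg (Finset.filter_subset _ _)
      fun _ _ _ => Nat.cast_nonneg _) hsum
  refine (Finset.sum_le_sum hrow).trans ?_
  rw [← Finset.mul_sum, ← Finset.sum_mul, ← Finset.mul_sum, ← Finset.mul_sum]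
  calc _ ≤ (κ ^ 3 * (4 * (M 2 d * count 2 d ^ 2)) + 27) *
        (κ ^ 3 * (4 * (M 2 d * count 2 d ^ 2)) * N) := by gcongr
    _ = _ := by ring

end Sparse

end

/-! ### From moment bounds to probabilities -/

/-- The variance factor of the second moment method. -/
noncomputable def momentFactor (r : ℝ) : ℝ := 1 + 4 / r + 8 / r ^ 2

lemma one_le_momentFactor {r : ℝ} (hr : 0 < r) : 1 ≤ momentFactor r := by
  unfold momentFactor
  have : 0 ≤ 4 / r + 8 / r ^ 2 := by positivity
  linarith

/-- For α = 1 the second factor is s⁴ + 4s³ + 8s², which is s⁴(1 + 4/s + 8/s²); powers of α are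
rounded up to α⁴. Here c is the correction 1 - 1/n_1. -/
lemma ratio_ge_of_quartic {F N α β s c r : ℝ} (hN : 0 < N) (hF : 0 ≤ F) (hα : 1 ≤ α) (hr : 0 < r)
    (hs : r ≤ s)
    (hle : (β ^ 2 * (s ^ 2 * c)) ^ 2 * N ^ 2 ≤
      F * ((α ^ 4 * s ^ 4 + 4 * (2 + α * s) * (α ^ 2 * s ^ 2)) * N)) :
    (β / α) ^ 4 * c ^ 2 / momentFactor r ≤ F / N := by
  have hs0 : 0 < s := hr.trans_le hs
  have hα0 : 0 < α := by linarith
  have hK := one_le_momentFactor hr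
  have e1 : 4 * s ^ 3 ≤ s ^ 4 * (4 / r) := by
    rw [mul_div_assoc', le_div_iff₀ hr]
    have : s ^ 3 * r ≤ s ^ 3 * s := by gcongr
    linarith
  have e2 : 8 * s ^ 2 ≤ s ^ 4 * (8 / r ^ 2) := by
    rw [mul_div_assoc', le_div_iff₀ (by positivity)]
    have : s ^ 2 * r ^ 2 ≤ s ^ 2 * s ^ 2 := by gcongr
    linarith
  have e3 : α ^ 4 * s ^ 4 + 4 * (2 + α * s) * (α ^ 2 * s ^ 2) ≤
      α ^ 4 * (s ^ 4 * momentFactor r) := by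
    have a1 : α ^ 3 ≤ α ^ 4 := pow_le_pow_right₀ hα (by norm_num)
    have a2 : α ^ 2 ≤ α ^ 4 := pow_le_pow_right₀ hα (by norm_num)
    calc _ = α ^ 4 * s ^ 4 + α ^ 3 * (4 * s ^ 3) + α ^ 2 * (8 * s ^ 2) := by ring
      _ ≤ α ^ 4 * s ^ 4 + α ^ 4 * (s ^ 4 * (4 / r)) + α ^ 4 * (s ^ 4 * (8 / r ^ 2)) := by gcongr
      _ = _ := by unfold momentFactor; ring
  have e4 : (β ^ 2 * (s ^ 2 * c)) ^ 2 * N ^ 2 ≤ F * ((α ^ 4 * (s ^ 4 * momentFactor r)) * N) :=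
    hle.trans (by gcongr)
  have e5 : (s ^ 4 * N) * (β ^ 4 * c ^ 2 * N) ≤ (s ^ 4 * N) * (F * (α ^ 4 * momentFactor r)) := by
    linarith
  have e6 := le_of_mul_le_mul_left e5 (by positivity)
  rw [div_pow, div_mul_eq_mul_div, div_div, div_le_div_iff₀ (by positivity) hN]
  exact e6

/-- The overlap term has relative size 108l / (16l²) = 6.75/l ≤ 8/r², so the same variance factor
serves as for cherries. -/
lemma ratio_ge_of_sextic {F N α β l c r : ℝ} (hN : 0 < N) (hF : 0 ≤ F) (hα : 1 ≤ α) (hr : 0 < r)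
    (hl : r ^ 2 ≤ l)
    (hle : (β ^ 3 * (4 * (l * c))) ^ 2 * N ^ 2 ≤
      F * ((α ^ 6 * (16 * l ^ 2) + 27 * (α ^ 3 * (4 * l))) * N)) :
    (β / α) ^ 6 * c ^ 2 / momentFactor r ≤ F / N := by
  have hl0 : 0 < l := (by positivity : 0 < r ^ 2).trans_le hl
  have hα0 : 0 < α := by linarith
  have hK := one_le_momentFactor hr
  have e2 : 108 * l ≤ 16 * l ^ 2 * (8 / r ^ 2) := by
    rw [mul_div_assoc', le_div_iff₀ (by positivity)]
    nlinarith [mul_le_mul_of_nonneg_left hl hl0.le]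
  have e3 : α ^ 6 * (16 * l ^ 2) + 27 * (α ^ 3 * (4 * l)) ≤
      α ^ 6 * (16 * l ^ 2 * momentFactor r) := by
    have a1 : α ^ 3 ≤ α ^ 6 := pow_le_pow_right₀ hα (by norm_num)
    have a2 : 0 ≤ α ^ 6 * (16 * l ^ 2 * (4 / r)) := by positivity
    calc _ = α ^ 6 * (16 * l ^ 2) + α ^ 3 * (108 * l) := by ring
      _ ≤ α ^ 6 * (16 * l ^ 2) + α ^ 6 * (16 * l ^ 2 * (8 / r ^ 2)) := by gcongr
      _ ≤ α ^ 6 * (16 * l ^ 2) + α ^ 6 * (16 * l ^ 2 * (8 / r ^ 2)) +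
          α ^ 6 * (16 * l ^ 2 * (4 / r)) := by linarith
      _ = _ := by unfold momentFactor; ring
  have e4 : (β ^ 3 * (4 * (l * c))) ^ 2 * N ^ 2 ≤
      F * ((α ^ 6 * (16 * l ^ 2 * momentFactor r)) * N) :=
    hle.trans (by gcongr)
  have e5 : (16 * l ^ 2 * N) * (β ^ 6 * c ^ 2 * N) ≤
      (16 * l ^ 2 * N) * (F * (α ^ 6 * momentFactor r)) := by
    linarith
  have e6 := le_of_mul_le_mul_left e5 (by positivity)
  rw [div_pow, div_mul_eq_mul_div, div_div, div_le_div_iff₀ (by positivity) hN]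
  exact e6

section

variable {n : ℕ} {d : Fin n → ℕ} {ε r : ℝ}

lemma M_two_le (d : Fin n → ℕ) : M 2 d ≤ maxDeg d * M 1 d := by
  rw [M_one, M, Finset.mul_sum]
  refine Finset.sum_le_sum fun i _ => ?_
  rw [descFactorial_two, mul_comm]
  exact Nat.mul_le_mul_right _ ((Nat.sub_le _ _).trans (le_maxDeg d i))

/-- From M_2 ≤ Δ M_1 ≤ Δ² M_1. It forces the number of leaves, or of vertices of degree two, to be
at least r/√ε under the count assumption, so that n_i - 1 and n_i - 2 may replace n_i at a
negligible cost. -/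
lemma Sparse.M_two_le (h : Sparse d ε) : (M 2 d : ℝ) ≤ ε * (M 1 d : ℝ) ^ 2 := by
  have h1 : (M 2 d : ℝ) ≤ maxDeg d * M 1 d := by exact_mod_cast DegSeq.M_two_le d
  have h2 : (1 : ℝ) ≤ maxDeg d := by exact_mod_cast h.maxDeg_pos
  have h3 := h.maxDeg_sq
  have h4 := h.M_pos
  calc (M 2 d : ℝ) ≤ maxDeg d * M 1 d := h1
    _ ≤ (maxDeg d : ℝ) ^ 2 * M 1 d := by gcongr; nlinarith
    _ ≤ ε * M 1 d * M 1 d := by gcongr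
    _ = _ := by ring

lemma Sparse.prob_ge_of_leaves (h : Sparse d ε) (hne : (realizations d).Nonempty) (hr : 0 < r)
    (hεr : 2 * √ε ≤ r) (hM2 : 0 < M 2 d)
    (hc : r * ((M 1 d : ℝ) / √(M 2 d : ℝ)) ≤ count 1 d) :
    ((1 - 29 * ε) / (1 + 28 * ε)) ^ 6 * (1 - 2 * (√ε / r)) ^ 4 / momentFactor r ≤
      prob d IsSymmetric := by
  classical
  have hε := h.eps_pos
  have hm := h.M_pos
  have hle := h.le
  have hN : (0 : ℝ) < (realizations d).card := by exact_mod_cast hne.card_pos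
  have hM2' : (0 : ℝ) < M 2 d := by exact_mod_cast hM2
  have hsq : 0 < √(M 2 d : ℝ) := Real.sqrt_pos.2 hM2'
  have hsε : 0 < √ε := Real.sqrt_pos.2 hε
  have hss : √(M 2 d : ℝ) ^ 2 = M 2 d := Real.sq_sqrt hM2'.le
  have hle2 : √(M 2 d : ℝ) ≤ √ε * M 1 d := by
    rw [← Real.sqrt_sq hm.le, ← Real.sqrt_mul hε.le]
    exact Real.sqrt_le_sqrt h.M_two_le
  have hcr : r / √ε ≤ count 1 d := by
    refine le_trans ?_ hc
    rw [div_eq_mul_inv]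
    gcongr
    rw [le_div_iff₀ hsq, inv_mul_le_iff₀ hsε]
    exact hle2
  have hc0 : (0 : ℝ) < count 1 d := (by positivity : 0 < r / √ε).trans_le hcr
  set x : ℝ := 1 / count 1 d with hx
  have hxy : x ≤ √ε / r := by
    rw [hx, div_le_div_iff₀ hc0 hr, one_mul]
    rwa [div_le_iff₀ hsε, mul_comm] at hcr
  have hy : √ε / r ≤ 1 / 2 := by
    rw [div_le_iff₀ hr]; linarith
  have hy0 : 0 ≤ √ε / r := by positivity
  have hx0 : 0 ≤ x := by positivity
  set s : ℝ := count 1 d * √(M 2 d : ℝ) / M 1 d with hs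
  have hrs : r ≤ s := by
    rw [hs, le_div_iff₀ hm]
    rwa [mul_div_assoc', div_le_iff₀ hsq] at hc
  have key := h.cherry_bound
  have hq : (count 1 d : ℝ) - 1 = count 1 d * (1 - x) := by
    rw [hx, mul_sub, mul_one, mul_one_div_cancel hc0.ne']
  have key2 : ((1 - 29 * ε) ^ 2 * (s ^ 2 * (1 - x))) ^ 2 * ((realizations d).card : ℝ) ^ 2 ≤
      ((realizations d).filter IsSymmetric).card *
      (((1 + 28 * ε) ^ 4 * s ^ 4 + 4 * (2 + (1 + 28 * ε) * s) * ((1 + 28 * ε) ^ 2 * s ^ 2)) *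
        (realizations d).card) := by
    refine le_trans (le_of_eq ?_) (key.trans (le_of_eq ?_))
    · rw [hq, hs, ← hss, Real.sqrt_sq hsq.le]
      field_simp
    · rw [hs]
      conv_lhs => rw [← hss, Real.sqrt_sq hsq.le]
      field_simp
  have fin := ratio_ge_of_quartic hN (Nat.cast_nonneg _) (by linarith) hr hrs key2
  have hq0 : 0 ≤ (1 - 29 * ε) / (1 + 28 * ε) := div_nonneg (by linarith) (by linarith)
  have hq1 : (1 - 29 * ε) / (1 + 28 * ε) ≤ 1 := by
    rw [div_le_one (by linarith)]; linarith
  have hK := one_le_momentFactor hr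
  have hpow : (1 - 2 * (√ε / r)) ^ 4 ≤ (1 - x) ^ 2 := by
    have h1 : (1 - 2 * (√ε / r)) ^ 4 ≤ (1 - 2 * (√ε / r)) ^ 2 :=
      pow_le_pow_of_le_one (by linarith) (by linarith) (by norm_num)
    exact h1.trans (pow_le_pow_left₀ (by linarith) (by linarith) 2)
  refine le_trans ?_ fin
  -- Exponent 4 suffices for cherries; it is weakened to 6 so that both alternatives give the same
  -- bound.
  have hpow2 : ((1 - 29 * ε) / (1 + 28 * ε)) ^ 6 ≤ ((1 - 29 * ε) / (1 + 28 * ε)) ^ 4 :=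
    pow_le_pow_of_le_one hq0 hq1 (by norm_num)
  gcongr

lemma Sparse.prob_ge_of_degree_two (h : Sparse d ε) (hne : (realizations d).Nonempty) (hr : 0 < r)
    (hεr : 2 * √ε ≤ r) (hM2 : 0 < M 2 d)
    (hc : r * √((M 1 d : ℝ) ^ 3 / (M 2 d : ℝ)) ≤ count 2 d) :
    ((1 - 29 * ε) / (1 + 28 * ε)) ^ 6 * (1 - 2 * (√ε / r)) ^ 4 / momentFactor r ≤
      prob d IsSymmetric := by
  classical
  have hε := h.eps_pos
  have hm := h.M_pos
  have hle := h.le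
  have hN : (0 : ℝ) < (realizations d).card := by exact_mod_cast hne.card_pos
  have hM2' : (0 : ℝ) < M 2 d := by exact_mod_cast hM2
  have hsε : 0 < √ε := Real.sqrt_pos.2 hε
  have hm1 : (1 : ℝ) ≤ M 1 d := by exact_mod_cast h.pos
  have hcr : r / √ε ≤ count 2 d := by
    refine le_trans ?_ hc
    rw [div_eq_mul_inv, ← Real.sqrt_inv]
    gcongr
    rw [le_div_iff₀ hM2', inv_mul_le_iff₀ hε]
    refine h.M_two_le.trans ?_
    gcongr
    norm_num
  have hc0 : (0 : ℝ) < count 2 d := (by positivity : 0 < r / √ε).trans_le hcr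
  have hc2 : 2 ≤ count 2 d := by
    have : (2 : ℝ) ≤ count 2 d := by
      refine le_trans ?_ hcr
      rw [le_div_iff₀ hsε]; exact hεr
    exact_mod_cast this
  set x : ℝ := 1 / count 2 d with hx
  have hxy : x ≤ √ε / r := by
    rw [hx, div_le_div_iff₀ hc0 hr, one_mul]
    rwa [div_le_iff₀ hsε, mul_comm] at hcr
  have hy : √ε / r ≤ 1 / 2 := by
    rw [div_le_iff₀ hr]; linarith
  have hy0 : 0 ≤ √ε / r := by positivity
  have hx0 : 0 ≤ x := by positivity
  set l : ℝ := count 2 d ^ 2 * M 2 d / M 1 d ^ 3 with hl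
  have hrl : r ^ 2 ≤ l := by
    have h1 := pow_le_pow_left₀ (by positivity) hc 2
    rw [mul_pow, Real.sq_sqrt (by positivity)] at h1
    rw [hl, le_div_iff₀ (by positivity)]
    rwa [mul_div_assoc', div_le_iff₀ hM2'] at h1
  have key := h.triangle_bound hc2
  have hq : ((count 2 d : ℝ) - 1) * (count 2 d - 2) =
      count 2 d ^ 2 * ((1 - x) * (1 - 2 * x)) := by
    rw [hx]; field_simp
  have key2 : ((1 - 29 * ε) ^ 3 * (4 * (l * ((1 - x) * (1 - 2 * x))))) ^ 2 *
      ((realizations d).card : ℝ) ^ 2 ≤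
      ((realizations d).filter IsSymmetric).card *
      (((1 + 28 * ε) ^ 6 * (16 * l ^ 2) + 27 * ((1 + 28 * ε) ^ 3 * (4 * l))) *
        (realizations d).card) := by
    refine le_trans (le_of_eq ?_) (key.trans (le_of_eq ?_))
    · rw [hq, hl]
      field_simp
    · rw [hl]
      field_simp
  have fin := ratio_ge_of_sextic hN (Nat.cast_nonneg _) (by linarith) hr hrl key2
  have hq0 : 0 ≤ (1 - 29 * ε) / (1 + 28 * ε) := div_nonneg (by linarith) (by linarith)
  have hK := one_le_momentFactor hr
  have hpow : (1 - 2 * (√ε / r)) ^ 4 ≤ ((1 - x) * (1 - 2 * x)) ^ 2 := by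
    have h1 : (1 - 2 * (√ε / r)) ^ 2 ≤ (1 - x) * (1 - 2 * x) := by
      rw [sq]
      exact mul_le_mul (by linarith) (by linarith) (by linarith) (by linarith)
    calc (1 - 2 * (√ε / r)) ^ 4 = ((1 - 2 * (√ε / r)) ^ 2) ^ 2 := by ring
      _ ≤ _ := pow_le_pow_left₀ (sq_nonneg _) h1 2
  refine le_trans ?_ fin
  gcongr

/-- A graph all of whose vertices have degree one is symmetric. -/
lemma isSymmetric_of_M_two_eq_zero (hn : 1 ≤ n) (hpos : ∀ i, 1 ≤ d i) (hM : M 2 d = 0)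
    {G : SimpleGraph (Fin n)} (hG : G ∈ realizations d) : IsSymmetric G := by
  classical
  have hd : ∀ i, d i = 1 := by
    intro i
    have h1 := descFactorial_two_le_M_two (d := d) i
    rw [hM, Nat.le_zero, Nat.descFactorial_eq_zero_iff_lt] at h1
    have := hpos i
    omega
  have h1 := mem_realizations.1 hG ⟨0, hn⟩
  rw [hd] at h1
  obtain ⟨v, hv⟩ := Finset.card_pos.1 (by rw [h1]; norm_num)
  simp only [Finset.mem_filter, Finset.mem_univ, true_and] at hv
  refine isSymmetric_of_twins hv.ne fun w hw1 hw2 => ⟨fun h => ?_, fun h => ?_⟩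
  · exact absurd (eq_of_adj_of_degree_one hG (hd _) h hv) hw2
  · exact absurd (eq_of_adj_of_degree_one hG (hd _) h hv.symm) hw1

lemma prob_eq_one {Q : SimpleGraph (Fin n) → Prop} (hne : (realizations d).Nonempty)
    (hQ : ∀ G ∈ realizations d, Q G) : prob d Q = 1 := by
  classical
  have hN : ((realizations d).card : ℝ) ≠ 0 := by exact_mod_cast hne.card_pos.ne'
  rw [prob, Finset.filter_true_of_mem hQ, div_self hN]

lemma prob_le_one (Q : SimpleGraph (Fin n) → Prop) : prob d Q ≤ 1 := by
  classical
  exact div_le_one_of_le₀ (by exact_mod_cast Finset.card_filter_le _ _) (Nat.cast_nonneg _)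

end

/-! ### Uniform bound and asymptotics -/

/-- A lower bound for the probability of being symmetric, for all sufficiently sparse degree
sequences with enough leaves or enough vertices of degree two. -/
theorem exists_prob_ge {r τ : ℝ} (hr : 0 < r) (hτ : τ < 1) : ∃ ε : ℝ, 0 < ε ∧
    ∀ (n : ℕ) (d : Fin n → ℕ), 1 ≤ n → (∀ i, 1 ≤ d i) → (realizations d).Nonempty →
      (maxDeg d : ℝ) ^ 2 ≤ ε * M 1 d →
      (r * ((M 1 d : ℝ) / √(M 2 d : ℝ)) ≤ count 1 d ∨
        r * √((M 1 d : ℝ) ^ 3 / (M 2 d : ℝ)) ≤ count 2 d) →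
      τ / momentFactor r ≤ prob d IsSymmetric := by
  have hK := one_le_momentFactor hr
  have hcont : ContinuousAt (fun ε : ℝ => ((1 - 29 * ε) / (1 + 28 * ε)) ^ 6 *
      (1 - 2 * (√ε / r)) ^ 4) 0 := by
    have h1 : ContinuousAt (fun ε : ℝ => (1 - 29 * ε) / (1 + 28 * ε)) 0 :=
      ContinuousAt.div (by fun_prop) (by fun_prop) (by norm_num)
    have h2 : ContinuousAt (fun ε : ℝ => 1 - 2 * (√ε / r)) 0 := by fun_prop
    exact (h1.pow 6).mul (h2.pow 4)
  have hev : ∀ᶠ ε : ℝ in 𝓝 0, τ < ((1 - 29 * ε) / (1 + 28 * ε)) ^ 6 *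
      (1 - 2 * (√ε / r)) ^ 4 :=
    hcont.eventually_const_lt (by simpa using hτ)
  have hev2 : ∀ᶠ ε : ℝ in 𝓝 0, 2 * √ε < r := by
    have : ContinuousAt (fun ε : ℝ => 2 * √ε) 0 := by fun_prop
    exact this.eventually_lt_const (by simpa using hr)
  have hev3 : ∀ᶠ ε : ℝ in 𝓝 0, ε < 1 / 29 := eventually_lt_nhds (by norm_num)
  have hall := ((hev.and (hev2.and hev3)).filter_mono nhdsWithin_le_nhds).and
    (self_mem_nhdsWithin (a := (0 : ℝ)) (s := Set.Ioi 0))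
  obtain ⟨ε, ⟨h1, h2, h3⟩, h4⟩ := hall.exists
  refine ⟨ε, h4, fun n d hn hpos hne hΔ hc => ?_⟩
  -- Division by zero gives 0, in agreement with the convention for M_2 = 0. The count assumption is
  -- then void, but the probability is 1.
  rcases Nat.eq_zero_or_pos (M 2 d) with hM2 | hM2
  · rw [prob_eq_one hne fun G hG => isSymmetric_of_M_two_eq_zero hn hpos hM2 hG,
      div_le_one (by linarith)]
    linarith
  have hM1 : 0 < M 1 d := by
    rw [M_one]
    exact Finset.sum_pos (fun i _ => hpos i) ⟨⟨0, hn⟩, Finset.mem_univ _⟩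
  have hs : Sparse d ε := ⟨hM1, h3.le, hΔ⟩
  have hdiv : τ / momentFactor r ≤ ((1 - 29 * ε) / (1 + 28 * ε)) ^ 6 *
      (1 - 2 * (√ε / r)) ^ 4 / momentFactor r := by
    gcongr
  refine hdiv.trans ?_
  rcases hc with hc | hc
  · exact hs.prob_ge_of_leaves hne hr h2.le hM2 hc
  · exact hs.prob_ge_of_degree_two hne hr h2.le hM2 hc

lemma tendsto_momentFactor : Tendsto momentFactor atTop (𝓝 1) := by
  have h1 : Tendsto (fun r : ℝ => 4 / r) atTop (𝓝 0) := tendsto_const_nhds.div_atTop tendsto_id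
  have h2 : Tendsto (fun r : ℝ => 8 / r ^ 2) atTop (𝓝 0) :=
    tendsto_const_nhds.div_atTop (tendsto_pow_atTop two_ne_zero)
  have h3 := ((tendsto_const_nhds (x := (1 : ℝ))).add h1).add h2
  rw [add_zero, add_zero] at h3
  exact h3

/-- The threshold ε depends only on r and τ, so Δ² = o(M_1) eventually meets it. Which of the two
alternatives holds may vary with n. -/
lemma Admissible.eventually_prob_ge {I : Set ℕ} {d : (n : ℕ) → Fin n → ℕ} (h : Admissible I d)
    {r τ : ℝ} (hr : 0 < r) (hτ : τ < 1)
    (hc : ∀ᶠ n in along I, r * ((M 1 (d n) : ℝ) / √(M 2 (d n) : ℝ)) ≤ count 1 (d n) ∨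
        r * √((M 1 (d n) : ℝ) ^ 3 / (M 2 (d n) : ℝ)) ≤ count 2 (d n)) :
    ∀ᶠ n in along I, τ / momentFactor r ≤ prob (d n) IsSymmetric := by
  obtain ⟨ε, hε, H⟩ := exists_prob_ge hr hτ
  have hI : ∀ᶠ n in along I, n ∈ I := mem_inf_of_right (mem_principal_self I)
  filter_upwards [hI, h.maxDeg_sq.bound hε, hc] with n hn h1 h2
  refine H n (d n) (h.index_pos n hn) (h.pos n hn) (h.graphical n hn) ?_ h2
  simpa using h1

lemma eventually_mul_le_of_isLittleO {l : Filter ℕ} {f : ℕ → ℝ} {g : ℕ → ℕ}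
    (hf : ∀ n, 0 ≤ f n) (h : f =o[l] fun n => (g n : ℝ)) {r : ℝ} (hr : 0 < r) :
    ∀ᶠ n in l, r * f n ≤ g n := by
  filter_upwards [h.bound (inv_pos.2 hr)] with n hn
  rw [Real.norm_of_nonneg (hf n), Real.norm_of_nonneg (Nat.cast_nonneg _)] at hn
  rwa [← le_inv_mul_iff₀ hr]

end DegSeq

open DegSeq
theorem theorem4 :
    -- part (a); `u = ω(v)` means `v = o(u)`
    (∀ (I : Set ℕ) (d : (n : ℕ) → Fin n → ℕ), Admissible I d →
      (((fun n => (M 1 (d n) : ℝ) / √(M 2 (d n) : ℝ)) =o[along I]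
          (fun n => (count 1 (d n) : ℝ))) ∨
        ((fun n => √((M 1 (d n) : ℝ) ^ 3 / (M 2 (d n) : ℝ))) =o[along I]
          (fun n => (count 2 (d n) : ℝ)))) →
      Tendsto (fun n => prob (d n) IsSymmetric) (along I) (𝓝 1)) ∧
    -- part (b); `δ` depends on `c` only
    (∀ c : ℝ, 0 < c → ∃ δ : ℝ, 0 < δ ∧
      ∀ (I : Set ℕ) (d : (n : ℕ) → Fin n → ℕ), Admissible I d →
        (∀ᶠ n in along I,
          (count 1 (d n) : ℝ) > c * ((M 1 (d n) : ℝ) / √(M 2 (d n) : ℝ)) ∨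
          (count 2 (d n) : ℝ) > c * √((M 1 (d n) : ℝ) ^ 3 / (M 2 (d n) : ℝ))) →
        ∀ᶠ n in along I, prob (d n) IsSymmetric > δ) := by
  refine ⟨fun I d h hc => ?_, fun c hc => ?_⟩
  · refine tendsto_order.2 ⟨fun a ha => ?_, fun a ha =>
      Eventually.of_forall fun n => (prob_le_one _).trans_lt ha⟩
    -- The bound `a` may be negative; a positive `b` allows the choice a < b < τ < 1 with K(r) <
    -- τ/b, whence τ/K(r) > b > a.
    obtain ⟨b, hb0, hab, hb1⟩ : ∃ b, 0 < b ∧ a < b ∧ b < 1 := by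
      obtain ⟨b, h1, h2⟩ := exists_between (max_lt ha one_pos)
      exact ⟨b, (le_max_right _ _).trans_lt h1, (le_max_left _ _).trans_lt h1, h2⟩
    obtain ⟨τ, hbτ, hτ⟩ := exists_between hb1
    have h1 : ∀ᶠ r : ℝ in atTop, momentFactor r < τ / b :=
      tendsto_momentFactor.eventually_lt_const ((one_lt_div hb0).2 hbτ)
    obtain ⟨r, h2, hr⟩ := (h1.and (eventually_gt_atTop (0 : ℝ))).exists
    have hK := one_le_momentFactor hr
    have hcr : ∀ᶠ n in along I, r * ((M 1 (d n) : ℝ) / √(M 2 (d n) : ℝ)) ≤ count 1 (d n) ∨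
        r * √((M 1 (d n) : ℝ) ^ 3 / (M 2 (d n) : ℝ)) ≤ count 2 (d n) := by
      rcases hc with hc | hc
      · exact (eventually_mul_le_of_isLittleO (fun n => by positivity) hc hr).mono
          fun n hn => Or.inl hn
      · exact (eventually_mul_le_of_isLittleO (fun n => by positivity) hc hr).mono
          fun n hn => Or.inr hn
    filter_upwards [h.eventually_prob_ge hr hτ hcr] with n hn
    refine hab.trans (lt_of_lt_of_le ?_ hn)
    rw [lt_div_iff₀ (by linarith)]
    rwa [lt_div_iff₀ hb0, mul_comm] at h2
  · have hK := one_le_momentFactor hc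
    -- The bound below is used with τ = 1/2; the smaller value 1/4 makes the inequality strict.
    refine ⟨1 / 4 / momentFactor c, by positivity, fun I d h hd => ?_⟩
    have h1 := h.eventually_prob_ge hc (τ := 1 / 2) (by norm_num)
      (hd.mono fun n hn => hn.imp le_of_lt le_of_lt)
    filter_upwards [h1] with n hn
    refine lt_of_lt_of_le ?_ hn
    gcongr
    norm_num
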